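/- Let $\mathcal W:\mathrm{Hom}(\mathbb R^d,\mathbb R^d)\to(-\infty,\infty]$ be an archetype whose symmetry group $\mathcal G=\{g\in GL(d):\ \mathcal W(B\circ g)=\mathcal W(B)\ \text{for all } B\}$ is contained in $SO(d)$ (that is, $\mathcal W$ is solid and undistorted) and is discrete. A \emph{body with discrete defects} with archetype $\mathcal W$ is a smooth $d$-manifold $\mathcal M$ with a volume form $\mathrm{Vol}$ and an energy density $W$ that admits an open cover $(U_\alpha)_\alpha$ and smooth closed $\mathbb R^d$-valued one-forms $P_\alpha$ on $U_\alpha$ such that, for every $p\in U_\alpha$, $P_\alpha(p):T_p\mathcal M\to\mathbb R^d$ is an isomorphism, $\mathrm{Vol}_p=P_\alpha(p)^*dx$, and $W_p(A)=\mathcal W(A\circ P_\alpha(p)^{-1})$ for all $A\in \mathrm{Hom}(T_p\mathcal M,\mathbb R^d)$. Its intrinsic metric is $G_p(X,Y)=P_\alpha(p)X\cdot P_\alpha(p)Y$ for $p\in U_\alpha$ (independent of $\alpha$), and the \emph{disclination content} $c_\gamma:T_p\mathcal M\to T_p\mathcal M$ of a piecewise smooth closed curve $\gamma$ based at $p$ is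 the parallel transport along $\gamma$ of the Levi-Civita connection of $G$. Then: 1. There is $\varepsilon>0$, depending only on $\mathcal W$, such that for every body with discrete defects with archetype $\mathcal W$ and every piecewise smooth closed curve $\gamma$ in it, based at $p$, either $c_\gamma=\mathrm{Id}_{T_p\mathcal M}$, or $|P_\alpha(p)\circ c_\gamma\circ P_\alpha(p)^{-1}-\mathrm{Id}|\ge\varepsilon$ in operator norm for every $\alpha$ with $p\in U_\alpha$ (equivalently, the distance of $c_\gamma$ from the identity in the operator norm of $G_p$ is at least $\varepsilon$). 2. Let $\mathcal M$ be a smooth $d$-manifold and let $\mathcal M^n\subset\mathcal M$ $(n\in\mathbb N)$ be open subsets, each of which is the body manifold of a body with discrete defects with archetype $\mathcal W$, with Levi-Civita connection $\nabla^n$. Then $(\nabla^n)$ does not converge to any smooth affine connection $\nabla$ on $\mathcal M$ with non-vanishing curvature, for any notion of convergence that implies convergence of parallel transport in the following sense: for every piecewise smooth closed curve $\gamma:[0,1]\to\mathcal M$ there are piecewise smooth closed curves $\gamma_n:[0,1]\to\mathcal M^n$ (for all sufficiently large $n$) that converge uniformly to $\gamma$, and for which the parallel transport of $\nabla^n$ along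 $\gamma_n$ converges, in the bundle $\mathrm{End}(T\mathcal M)$, to the parallel transport of $\nabla$ along $\gamma$. -/

import Mathlib

open Set Filter Topology Bundle
open scoped Manifold ContDiff

universe u w

namespace DiscreteDefects

/-- Euclidean space `ℝ^d`. -/
abbrev Euc (d : ℕ) : Type := EuclideanSpace ℝ (Fin d)

/-! ### Archetypes and their symmetry groups -/

/-- An archetype: an energy density on the linear maps of `ℝ^d`, with values in `(-∞, ∞]`. -/
abbrev Archetype (d : ℕ) : Type := (Euc d →L[ℝ] Euc d) → WithTop ℝ

/-- The symmetry group of an archetype: all `g ∈ GL(d)` with `𝒲 (B ∘ g) = 𝒲 B` for every `B`. It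
carries the topology of `GL(d)`. -/
def symmetryGroup {d : ℕ} (𝒲 : Archetype d) : Subgroup (Euc d →L[ℝ] Euc d)ˣ where
  carrier := {g | ∀ B : Euc d →L[ℝ] Euc d, 𝒲 (B ∘L (g : Euc d →L[ℝ] Euc d)) = 𝒲 B}
  mul_mem' := by
    intro g h hg hh B
    have h1 := hh (B ∘L (g : Euc d →L[ℝ] Euc d))
    rw [hg B] at h1
    exact h1
  one_mem' := fun B => rfl
  inv_mem' := by
    intro g hg B
    have h1 := hg (B ∘L ((g⁻¹ : (Euc d →L[ℝ] Euc d)ˣ) : Euc d →L[ℝ] Euc d))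
    have h2 : (B ∘L ((g⁻¹ : (Euc d →L[ℝ] Euc d)ˣ) : Euc d →L[ℝ] Euc d)) ∘L
        (g : Euc d →L[ℝ] Euc d) = B := by
      rw [ContinuousLinearMap.comp_assoc]
      have h3 : ((g⁻¹ : (Euc d →L[ℝ] Euc d)ˣ) : Euc d →L[ℝ] Euc d) ∘L
          (g : Euc d →L[ℝ] Euc d) = ContinuousLinearMap.id ℝ (Euc d) := g.inv_mul
      rw [h3, ContinuousLinearMap.comp_id]
    rw [h2] at h1
    exact h1.symm

/-- The elements of `SO(d)`: linear isometries of `ℝ^d` with determinant one. -/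
def IsRotation {d : ℕ} (g : Euc d →L[ℝ] Euc d) : Prop :=
  (∀ v, ‖g v‖ = ‖v‖) ∧ g.det = 1

/-- A (solid) undistorted archetype: the symmetry group is contained in `SO(d)`. -/
def IsUndistorted {d : ℕ} (𝒲 : Archetype d) : Prop :=
  ∀ g ∈ symmetryGroup 𝒲, IsRotation (g : Euc d →L[ℝ] Euc d)

/-! ### Bodies -/

section Bodies

variable (d : ℕ) (M : Type u) [TopologicalSpace M] [ChartedSpace (Euc d) M]
  [IsManifold (𝓡 d) ∞ M]

/-- A hyperelastic body whose body manifold is an open submanifold `carrier` of `M` (all of `M` for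
a body with body manifold `M`). The volume form `vol` fixes the orientation. The values of `W` and
`vol` outside `carrier` are irrelevant. -/
structure HyperelasticBody where
  /-- the body manifold -/
  carrier : Set M
  isOpen_carrier : IsOpen carrier
  /-- the energy density (constitutive relation) -/
  W : (p : M) → (TangentSpace (𝓡 d) p →L[ℝ] Euc d) → WithTop ℝ
  /-- the volume form -/
  vol : (p : M) → (TangentSpace (𝓡 d) p) [⋀^Fin d]→ₗ[ℝ] ℝ
  vol_smooth : ∀ X : Fin d → (p : M) → TangentSpace (𝓡 d) p,
    (∀ i, ContMDiffOn (𝓡 d) (𝓡 d).tangent ∞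
      (fun p => (⟨p, X i p⟩ : TangentBundle (𝓡 d) M)) carrier) →
    ContMDiffOn (𝓡 d) 𝓘(ℝ, ℝ) ∞ (fun p => vol p (fun i => X i p)) carrier
  vol_ne_zero : ∀ p ∈ carrier, vol p ≠ 0

variable {d}

/-- A hyperelastic smooth uniform body with archetype `𝒲`, together with a lattice structure: an
open cover `U α` of the body manifold and smooth `ℝ^d`-valued one-forms `P α` on `U α`. -/
structure UniformBody (𝒲 : Archetype d) extends HyperelasticBody d M where
  /-- the index set of the lattice structure -/
  ι : Type w
  /-- the reference neighborhoods -/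
  U : ι → Set M
  isOpen_U : ∀ α, IsOpen (U α)
  iUnion_U : ⋃ α, U α = carrier
  /-- the reference maps -/
  P : ι → (p : M) → TangentSpace (𝓡 d) p →L[ℝ] Euc d
  P_smooth : ∀ α, ContMDiffOn (𝓡 d) ((𝓡 d).prod 𝓘(ℝ, Euc d →L[ℝ] Euc d)) ∞
    (fun p => (TotalSpace.mk' (Euc d →L[ℝ] Euc d) p (P α p) :
      TotalSpace (Euc d →L[ℝ] Euc d)
        (fun q : M => TangentSpace (𝓡 d) q →L[ℝ] Bundle.Trivial M (Euc d) q))) (U α)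
  P_invertible : ∀ α, ∀ p ∈ U α, (P α p).IsInvertible
  /-- `Vol = (P α)^* dx` -/
  vol_eq : ∀ α, ∀ p ∈ U α, ∀ v : Fin d → TangentSpace (𝓡 d) p,
    vol p v = (EuclideanSpace.basisFun (Fin d) ℝ).toBasis.det (fun i => P α p (v i))
  /-- `W_p (A) = 𝒲 (A ∘ (P α p)⁻¹)` -/
  W_eq : ∀ α, ∀ p ∈ U α, ∀ A : TangentSpace (𝓡 d) p →L[ℝ] Euc d,
    W p A = 𝒲 (A ∘L (P α p).inverse)

variable {M}

/-- An `ℝ^d`-valued one-form `P` is closed on the open set `U`: its exterior derivative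
`dP (X, Y) = X (P Y) - Y (P X) - P [X, Y]` vanishes at the points of `U`. -/
def IsClosedFormOn (P : (p : M) → TangentSpace (𝓡 d) p →L[ℝ] Euc d) (U : Set M) : Prop :=
  ∀ p ∈ U, ∀ X Y : (q : M) → TangentSpace (𝓡 d) q,
    MDifferentiableAt (𝓡 d) (𝓡 d).tangent (fun q => (⟨q, X q⟩ : TangentBundle (𝓡 d) M)) p →
    MDifferentiableAt (𝓡 d) (𝓡 d).tangent (fun q => (⟨q, Y q⟩ : TangentBundle (𝓡 d) M)) p →
    mvfderiv (𝓡 d) (fun q => P q (Y q)) p (X p) - mvfderiv (𝓡 d) (fun q => P q (X q)) p (Y p)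
      - P p (VectorField.mlieBracket (𝓡 d) X Y p) = 0

variable (M) in
/-- A body with discrete defects: a uniform body whose reference maps are closed one-forms. -/
structure DefectBody (𝒲 : Archetype d) extends UniformBody.{u, w} M 𝒲 where
  P_closed : ∀ α, IsClosedFormOn (P α) (U α)

open Classical in
/-- The intrinsic Riemannian metric `G_p (X, Y) = P α p X ⋅ P α p Y`, `p ∈ U α`, of a uniform body;
see `UniformBody.metric_eq` for its independence of `α`. -/
noncomputable def UniformBody.metric {𝒲 : Archetype d} (B : UniformBody.{u, w} M 𝒲)
    (p : M) (X Y : TangentSpace (𝓡 d) p) : ℝ :=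
  if h : ∃ α, p ∈ B.U α then inner ℝ (B.P h.choose p X) (B.P h.choose p Y) else 0

theorem UniformBody.metric_eq {𝒲 : Archetype d} (B : UniformBody.{u, w} M 𝒲)
    (h𝒲 : IsUndistorted 𝒲) {α : B.ι} {p : M} (hp : p ∈ B.U α) (X Y : TangentSpace (𝓡 d) p) :
    B.metric p X Y = inner ℝ (B.P α p X) (B.P α p Y) := by
  have h : ∃ α, p ∈ B.U α := ⟨α, hp⟩
  rw [UniformBody.metric, dif_pos h]
  obtain ⟨e, he⟩ := B.P_invertible α p hp
  obtain ⟨f, hf⟩ := B.P_invertible h.choose p h.choose_spec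
  have h1 := B.W_eq α p hp
  have h2 := B.W_eq h.choose p h.choose_spec
  rw [← he] at h1 ⊢
  rw [← hf] at h2 ⊢
  rw [ContinuousLinearMap.inverse_equiv] at h1 h2
  let g : (Euc d →L[ℝ] Euc d)ˣ := ContinuousLinearEquiv.unitsEquiv ℝ (Euc d) |>.symm (f.symm.trans e)
  have hg : g ∈ symmetryGroup 𝒲 := by
    intro C
    have h3 := h1 (C ∘L (e : TangentSpace (𝓡 d) p →L[ℝ] Euc d))
    have h4 := h2 (C ∘L (e : TangentSpace (𝓡 d) p →L[ℝ] Euc d))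
    rw [h3] at h4
    have h5 : (C ∘L (e : TangentSpace (𝓡 d) p →L[ℝ] Euc d)) ∘L
        (e.symm : Euc d →L[ℝ] TangentSpace (𝓡 d) p) = C := by
      ext v i
      simp
    rw [h5] at h4
    exact h4.symm
  have hi := (h𝒲 g hg).1
  have hgv : ∀ v : TangentSpace (𝓡 d) p, (g : Euc d →L[ℝ] Euc d) (f v) = e v := by
    intro v
    show e (f.symm (f v)) = e v
    simp
  let L : Euc d →ₗᵢ[ℝ] Euc d := ⟨(g : Euc d →L[ℝ] Euc d).toLinearMap, hi⟩
  have h6 := L.inner_map_map (f X) (f Y)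
  have h7 : ∀ v, L (f v) = e v := hgv
  rw [h7, h7] at h6
  exact h6.symm

end Bodies

/-! ### Connections, parallel transport, curvature -/

section Connections

variable (d : ℕ) (M : Type u) [TopologicalSpace M] [ChartedSpace (Euc d) M]

/-- The operator `σ ↦ ∇ σ` of an affine connection, where `∇ σ x v` stands for `(∇_v σ)(x)`. It is a
connection on `U` if it satisfies `IsCovariantDerivativeOn (Euc d) ∇ U`. -/
abbrev Conn : Type u :=
  ((x : M) → TangentSpace (𝓡 d) x) →
    ((x : M) → TangentSpace (𝓡 d) x →L[ℝ] TangentSpace (𝓡 d) x)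

variable {d M} [IsManifold (𝓡 d) ∞ M]

/-- `D` is the Levi-Civita connection of the intrinsic metric of the body `B`, on the body manifold:
it is a torsion-free connection there, and compatible with the metric. -/
structure UniformBody.IsLeviCivita {𝒲 : Archetype d} (B : UniformBody.{u, w} M 𝒲)
    (D : Conn d M) : Prop where
  isCovariantDerivativeOn : IsCovariantDerivativeOn (Euc d) D B.carrier
  torsion_free : ∀ p ∈ B.carrier, ∀ X Y : (q : M) → TangentSpace (𝓡 d) q,
    MDifferentiableAt (𝓡 d) (𝓡 d).tangent (fun q => (⟨q, X q⟩ : TangentBundle (𝓡 d) M)) p →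
    MDifferentiableAt (𝓡 d) (𝓡 d).tangent (fun q => (⟨q, Y q⟩ : TangentBundle (𝓡 d) M)) p →
    D Y p (X p) - D X p (Y p) = VectorField.mlieBracket (𝓡 d) X Y p
  metric_compatible : ∀ p ∈ B.carrier, ∀ (v : TangentSpace (𝓡 d) p)
    (X Y : (q : M) → TangentSpace (𝓡 d) q),
    MDifferentiableAt (𝓡 d) (𝓡 d).tangent (fun q => (⟨q, X q⟩ : TangentBundle (𝓡 d) M)) p →
    MDifferentiableAt (𝓡 d) (𝓡 d).tangent (fun q => (⟨q, Y q⟩ : TangentBundle (𝓡 d) M)) p →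
    mvfderiv (𝓡 d) (fun q => B.metric q (X q) (Y q)) p v
      = B.metric p (D X p v) (Y p) + B.metric p (X p) (D Y p v)

/-- `Q` holds on each interval of some subdivision of `[0, 1]`. -/
def Piecewise (Q : Set ℝ → Prop) : Prop :=
  ∃ (k : ℕ) (t : ℕ → ℝ), t 0 = 0 ∧ t k = 1 ∧
    ∀ i < k, t i < t (i + 1) ∧ Q (Icc (t i) (t (i + 1)))

variable (d) in
/-- `γ` restricts to a piecewise smooth closed curve `[0, 1] → M` based at `p`. -/
def IsClosedCurve (γ : ℝ → M) (p : M) : Prop :=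
  γ 0 = p ∧ γ 1 = p ∧ Piecewise (fun J => ContMDiffOn 𝓘(ℝ, ℝ) (𝓡 d) ∞ γ J)

/-- The vector field `V` along the curve `γ t = (V t).proj` is parallel on the interval `J`, where
`γ` is smooth. In the trivialization of `TM` given by the chart at `γ t` the equation
`∇_{γ'} V = 0` reads `v' = - ∇_{γ'} s`, where `v` is the representative of `V` and `s` is the local
vector field with constant representative `v t`. -/
def IsParallelOn (D : Conn d M) (V : ℝ → TangentBundle (𝓡 d) M) (J : Set ℝ) : Prop :=
  ContMDiffOn 𝓘(ℝ, ℝ) (𝓡 d) ∞ (fun τ => (V τ).proj) J ∧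
  ∀ t ∈ J, HasDerivWithinAt
    (fun τ => (trivializationAt (Euc d) (TangentSpace (𝓡 d)) (V t).proj (V τ)).2)
    (- D (fun x => (trivializationAt (Euc d) (TangentSpace (𝓡 d)) (V t).proj).symm x (V t).snd)
        (V t).proj (mfderivWithin 𝓘(ℝ, ℝ) (𝓡 d) (fun τ => (V τ).proj) J t (1 : ℝ)) : Euc d) J t

/-- `h : T_pM → T_qM` is the parallel transport of `D` along the piecewise smooth curve
`γ : [0, 1] → M` from `p` to `q`: every `v ∈ T_pM` extends to a parallel field along `γ` that ends
in `h v`. -/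
def IsParallelTransport (D : Conn d M) (γ : ℝ → M) {p q : M}
    (h : TangentSpace (𝓡 d) p →L[ℝ] TangentSpace (𝓡 d) q) : Prop :=
  ∀ v : TangentSpace (𝓡 d) p, ∃ V : ℝ → TangentBundle (𝓡 d) M,
    (∀ t ∈ Icc (0 : ℝ) 1, (V t).proj = γ t) ∧ V 0 = ⟨p, v⟩ ∧ V 1 = ⟨q, h v⟩ ∧
    Piecewise (IsParallelOn D V)

/-- `c` is the disclination content of the closed curve `γ` in the body `B`, based at `p`: the
holonomy along `γ` of the Levi-Civita connection of `B`. -/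
def DefectBody.IsDisclinationContent {𝒲 : Archetype d} (B : DefectBody.{u, w} M 𝒲)
    (γ : ℝ → M) {p : M} (c : TangentSpace (𝓡 d) p →L[ℝ] TangentSpace (𝓡 d) p) : Prop :=
  IsClosedCurve d γ p ∧ MapsTo γ (Icc 0 1) B.carrier ∧
    ∃ D : Conn d M, B.IsLeviCivita D ∧ IsParallelTransport D γ c

/-- The curvature `R(X, Y) Z = ∇_X ∇_Y Z - ∇_Y ∇_X Z - ∇_[X, Y] Z`. -/
noncomputable def curvature (D : Conn d M) (X Y Z : (x : M) → TangentSpace (𝓡 d) x) (p : M) :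
    TangentSpace (𝓡 d) p :=
  D (fun q => D Z q (Y q)) p (X p) - D (fun q => D Z q (X q)) p (Y p)
    - D Z p (VectorField.mlieBracket (𝓡 d) X Y p)

/-- A connection on `M` is flat if its curvature vanishes on smooth vector fields. -/
def IsFlat (D : Conn d M) : Prop :=
  ∀ X Y Z : (x : M) → TangentSpace (𝓡 d) x,
    ContMDiff (𝓡 d) (𝓡 d).tangent ∞ (fun q => (⟨q, X q⟩ : TangentBundle (𝓡 d) M)) →
    ContMDiff (𝓡 d) (𝓡 d).tangent ∞ (fun q => (⟨q, Y q⟩ : TangentBundle (𝓡 d) M)) →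
    ContMDiff (𝓡 d) (𝓡 d).tangent ∞ (fun q => (⟨q, Z q⟩ : TangentBundle (𝓡 d) M)) →
    ∀ p, curvature D X Y Z p = 0

/-- Convergence of the parallel transport of connections `D n`, given on open sets `N n` of `M`, to
that of a connection `D'` on `M`: every closed curve `γ` of `M` is a uniform limit of closed curves
`γ' n` of `N n` such that the parallel transport of `D n` along `γ' n` converges, in the bundle of
endomorphisms of `TM`, to the parallel transport of `D'` along `γ`. (One may take `γ' n = γ` if `γ`
lies in `N n`; in general `γ` may run through the defects. Uniform convergence is expressed as
continuous convergence.) -/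
def ParallelTransportConverges (N : ℕ → Set M) (D : ℕ → Conn d M) (D' : Conn d M) : Prop :=
  ∀ (γ : ℝ → M) (p : M), IsClosedCurve d γ p →
    ∃ (h : TangentSpace (𝓡 d) p →L[ℝ] TangentSpace (𝓡 d) p) (γ' : ℕ → ℝ → M) (p' : ℕ → M)
      (h' : (n : ℕ) → TangentSpace (𝓡 d) (p' n) →L[ℝ] TangentSpace (𝓡 d) (p' n)),
      IsParallelTransport D' γ h ∧
      (∀ᶠ n in atTop, IsClosedCurve d (γ' n) (p' n) ∧ MapsTo (γ' n) (Icc 0 1) (N n) ∧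
        IsParallelTransport (D n) (γ' n) (h' n)) ∧
      (∀ t ∈ Icc (0 : ℝ) 1,
        Tendsto (fun x : ℕ × ℝ => γ' x.1 x.2) (atTop ×ˢ 𝓝[Icc 0 1] t) (𝓝 (γ t))) ∧
      Tendsto (fun n => (TotalSpace.mk' (Euc d →L[ℝ] Euc d) (p' n) (h' n) :
          TotalSpace (Euc d →L[ℝ] Euc d)
            (fun x : M => TangentSpace (𝓡 d) x →L[ℝ] TangentSpace (𝓡 d) x))) atTop
        (𝓝 (TotalSpace.mk' (Euc d →L[ℝ] Euc d) p h))

end Connections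

end DiscreteDefects

set_option maxSynthPendingDepth 3

namespace DiscreteDefects

/-! Let `G` be the symmetry group of the archetype. Two reference maps at a point differ by an
element of `G`, since `W_p` can be read through either of them. For a closed coframe `P α`, the
connection that makes `P α` parallel is torsion-free and preserves the metric, so it is the
Levi-Civita connection on `U α` (`DefectBody.eq_flatConn`). Hence the components `P α (V)` of a
parallel field are constant as long as the curve stays in `U α`. Along a closed curve, cut by a
Lebesgue number argument into arcs that each lie in one `U β`, only finitely many transitions in `G`
accumulate. Conjugated by `P α p`, the holonomy is therefore an element of `G`
(`DefectBody.exists_symmetry`). As `G` is discrete, its elements other than `1` stay at a fixed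
distance from `1`, which is the first claim.

For the second claim that gap is awkward: it is measured in the intrinsic metrics of the bodies, and
these need not converge. It is replaced by an algebraic relation. A discrete group of isometries of
`ℝ^d` is finite, so with `N = |G|` every holonomy `h` of every body satisfies `h ^ N = 1`. This
relation is invariant under conjugation and closed in the endomorphism bundle
(`pow_eq_one_of_tendsto`), so the holonomies of the limit connection satisfy it too. Around a loop
of size `s` at `p`, however, the holonomy of a smooth connection is `1 - (s ^ 2 / 60) R(x, y) + o(s
^ 2)` (`eventually_norm_parallelTransport_sub_le`), whose `N`-th power is `1 - N (s ^ 2 / 60) R(x,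
y) + o(s ^ 2)`. Hence `R = 0` (`eq_zero_of_pow_eq_one`). -/

/-! ### Calculus on subdivided intervals. -/

theorem Piecewise.exists_right {Q : Set ℝ → Prop} (h : Piecewise Q) {t : ℝ}
    (ht : t ∈ Ico (0 : ℝ) 1) : ∃ a b, a ≤ t ∧ t < b ∧ Q (Icc a b) := by
  obtain ⟨k, τ, h0, h1, hQ⟩ := h
  have key : ∀ i ≤ k, t < τ i → ∃ a b, a ≤ t ∧ t < b ∧ Q (Icc a b) := by
    intro i
    induction i with
    | zero => intro _ hi; rw [h0] at hi; exact absurd ht.1 (not_le.2 hi)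
    | succ i ih =>
      intro hik hi
      rcases lt_or_ge t (τ i) with h2 | h2
      · exact ih (by omega) h2
      · exact ⟨τ i, τ (i + 1), h2, hi, (hQ i (by omega)).2⟩
  exact key k le_rfl (h1 ▸ ht.2)

theorem Piecewise.exists_left {Q : Set ℝ → Prop} (h : Piecewise Q) {t : ℝ}
    (ht : t ∈ Ioc (0 : ℝ) 1) : ∃ a b, a < t ∧ t ≤ b ∧ Q (Icc a b) := by
  obtain ⟨k, τ, h0, h1, hQ⟩ := h
  have key : ∀ i ≤ k, t ≤ τ i → ∃ a b, a < t ∧ t ≤ b ∧ Q (Icc a b) := by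
    intro i
    induction i with
    | zero => intro _ hi; rw [h0] at hi; exact absurd ht.1 (not_lt.2 hi)
    | succ i ih =>
      intro hik hi
      rcases le_or_gt t (τ i) with h2 | h2
      · exact ih (by omega) h2
      · exact ⟨τ i, τ (i + 1), h2, hi, (hQ i (by omega)).2⟩
  exact key k le_rfl (h1 ▸ ht.2)

/-- A map that is continuous on the pieces of a subdivision is continuous. -/
theorem Piecewise.continuousOn {X : Type*} [TopologicalSpace X] {Q : Set ℝ → Prop}
    (h : Piecewise Q) {f : ℝ → X} {a b : ℝ} (ha : 0 ≤ a) (hb : b ≤ 1)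
    (hf : ∀ c d, c < d → Q (Icc c d) → ∀ t ∈ Icc c d, t ∈ Icc a b →
      ContinuousWithinAt f (Icc c d) t) :
    ContinuousOn f (Icc a b) := by
  intro t ht
  have hl : ContinuousWithinAt f (Icc a t) t := by
    rcases eq_or_lt_of_le ht.1 with h1 | h1
    · subst h1; rw [Icc_self]; exact continuousWithinAt_singleton
    obtain ⟨c, d, hc, hd, hQ⟩ := h.exists_left (t := t) ⟨by linarith, by linarith [ht.2]⟩
    have h2 := hf c d (by linarith) hQ t ⟨hc.le, hd⟩ ht
    refine h2.mono_of_mem_nhdsWithin ?_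
    refine mem_of_superset (inter_mem_nhdsWithin _ (Ioi_mem_nhds hc)) ?_
    rintro x ⟨hx, hx'⟩
    exact ⟨le_of_lt hx', hx.2.trans hd⟩
  have hr : ContinuousWithinAt f (Icc t b) t := by
    rcases eq_or_lt_of_le ht.2 with h1 | h1
    · subst h1; rw [Icc_self]; exact continuousWithinAt_singleton
    obtain ⟨c, d, hc, hd, hQ⟩ := h.exists_right (t := t) ⟨by linarith [ht.1], by linarith⟩
    have h2 := hf c d (by linarith) hQ t ⟨hc, hd.le⟩ ht
    refine h2.mono_of_mem_nhdsWithin ?_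
    refine mem_of_superset (inter_mem_nhdsWithin _ (Iio_mem_nhds hd)) ?_
    rintro x ⟨hx, hx'⟩
    exact ⟨hc.trans hx.1, le_of_lt hx'⟩
  rw [← Icc_union_Icc_eq_Icc ht.1 ht.2]
  exact hl.union hr

/-- A map with prescribed derivative on the pieces of a subdivision is continuous and has this
right derivative. -/
theorem Piecewise.hasDerivWithinAt {E : Type*} [NormedAddCommGroup E] [NormedSpace ℝ E]
    {Q : Set ℝ → Prop} (h : Piecewise Q) {f f' : ℝ → E} {a b : ℝ} (ha : 0 ≤ a) (hb : b ≤ 1)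
    (hf : ∀ c d, c < d → Q (Icc c d) → ∀ t ∈ Icc c d, t ∈ Icc a b →
      HasDerivWithinAt f (f' t) (Icc c d) t) :
    ContinuousOn f (Icc a b) ∧ ∀ t ∈ Ico a b, HasDerivWithinAt f (f' t) (Ici t) t := by
  refine ⟨h.continuousOn ha hb fun c d hcd hQ t ht ht' =>
    (hf c d hcd hQ t ht ht').continuousWithinAt, fun t ht => ?_⟩
  obtain ⟨c, d, hc, hd, hQ⟩ := h.exists_right (t := t) ⟨ha.trans ht.1, by linarith [ht.2]⟩
  refine (hf c d (by linarith) hQ t ⟨hc, hd.le⟩ ⟨ht.1, ht.2.le⟩).mono_of_mem_nhdsWithin ?_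
  refine mem_of_superset (inter_mem_nhdsWithin _ (Iio_mem_nhds hd)) ?_
  rintro x ⟨hx, hx'⟩
  exact ⟨hc.trans hx, le_of_lt hx'⟩

/-! ### Roots of unity near the identity; discrete groups of isometries. -/

/-- In `(∑ H ^ i) * (H - 1) = H ^ N - 1 = 0`, divide by `r` and let `r → 0`: then `H → 1`, the sum
tends to `N`, and `(H - 1) / r → -F`, so `N • F = 0`. In the application `r` is the square of the
size of a loop and `F` is a multiple of the curvature. -/
theorem eq_zero_of_pow_eq_one {A : Type*} [NormedRing A] [NormedAlgebra ℝ A] {F : A} {N : ℕ}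
    (hN : 0 < N)
    (h : ∀ ε > (0 : ℝ), ∃ r : ℝ, 0 < r ∧ r < ε ∧ ∃ H : A, H ^ N = 1 ∧ ‖H - 1 + r • F‖ ≤ ε * r) :
    F = 0 := by
  choose r hr0 hr H hH hF using fun n : ℕ => h (1 / ((n : ℝ) + 1)) (by positivity)
  have hr_lim : Tendsto r atTop (𝓝 0) :=
    squeeze_zero (fun n => (hr0 n).le) (fun n => (hr n).le) tendsto_one_div_add_atTop_nhds_zero_nat
  have h1 : Tendsto (fun n => (r n)⁻¹ • (H n - 1)) atTop (𝓝 (-F)) := by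
    rw [tendsto_iff_norm_sub_tendsto_zero]
    refine squeeze_zero (fun n => norm_nonneg _) (fun n => ?_)
      tendsto_one_div_add_atTop_nhds_zero_nat
    have h2 : (r n)⁻¹ • (H n - 1) - -F = (r n)⁻¹ • (H n - 1 + r n • F) := by
      rw [smul_add, smul_smul, inv_mul_cancel₀ (hr0 n).ne', one_smul, sub_neg_eq_add]
    rw [h2, norm_smul, Real.norm_eq_abs, abs_of_pos (inv_pos.2 (hr0 n))]
    calc (r n)⁻¹ * ‖H n - 1 + r n • F‖ ≤ (r n)⁻¹ * (1 / ((n : ℝ) + 1) * r n) :=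
          mul_le_mul_of_nonneg_left (hF n) (inv_pos.2 (hr0 n)).le
      _ = 1 / ((n : ℝ) + 1) := by field_simp [(hr0 n).ne']
  have h3 : Tendsto H atTop (𝓝 1) := by
    have h4 := (hr_lim.smul h1).add_const (1 : A)
    simp only [zero_smul, zero_add] at h4
    refine h4.congr fun n => ?_
    rw [smul_smul, mul_inv_cancel₀ (hr0 n).ne', one_smul, sub_add_cancel]
  have h5 : Tendsto (fun n => (∑ i ∈ Finset.range N, H n ^ i) * ((r n)⁻¹ • (H n - 1))) atTop
      (𝓝 ((∑ i ∈ Finset.range N, (1 : A) ^ i) * -F)) :=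
    (tendsto_finsetSum _ fun i _ => h3.pow i).mul h1
  have h6 : ∀ n, (∑ i ∈ Finset.range N, H n ^ i) * ((r n)⁻¹ • (H n - 1)) = 0 := by
    intro n
    rw [mul_smul_comm, geom_sum_mul, hH, sub_self, smul_zero]
  simp only [h6] at h5
  have h7 := tendsto_nhds_unique h5 tendsto_const_nhds
  simp only [one_pow, Finset.sum_const, Finset.card_range, nsmul_eq_mul, mul_one, mul_neg,
    neg_eq_zero] at h7
  have h8 : (N : ℝ) • F = 0 := by
    rw [← h7, ← nsmul_eq_mul, Nat.cast_smul_eq_nsmul]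
  exact (smul_eq_zero.1 h8).resolve_left (by exact_mod_cast hN.ne')

/-- A discrete group of linear isometries has no elements near the identity. -/
theorem exists_forall_le_norm_sub {d : ℕ} {G : Subgroup (Euc d →L[ℝ] Euc d)ˣ}
    (hdisc : DiscreteTopology G) :
    ∃ ε : ℝ, 0 < ε ∧ ∀ g ∈ G, g = 1 ∨
      ε ≤ ‖(g : Euc d →L[ℝ] Euc d) - ContinuousLinearMap.id ℝ (Euc d)‖ := by
  have h1 : {(1 : G)} ∈ 𝓝 (1 : G) := (isOpen_discrete _).mem_nhds rfl
  rw [nhds_subtype_eq_comap, mem_comap] at h1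
  obtain ⟨s, hs, hs'⟩ := h1
  -- The units are open in the algebra of endomorphisms, so a neighborhood of `1` in `GL(d)`
  -- contains an operator norm ball.
  have h2 := (Units.isOpenEmbedding_val (R := Euc d →L[ℝ] Euc d)).isOpenMap.image_mem_nhds hs
  obtain ⟨ε, hε, hb⟩ := Metric.mem_nhds_iff.1 h2
  refine ⟨ε, hε, fun g hg => ?_⟩
  by_contra! hc
  obtain ⟨k, hk, hkg⟩ := hb (mem_ball_iff_norm.2 hc.2)
  have h3 : k = g := Units.ext hkg
  subst h3
  have h4 := @hs' ⟨k, hg⟩ hk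
  exact hc.1 (congrArg Subtype.val h4)

/-- A discrete group of linear isometries is finite. -/
theorem finite_of_discrete {d : ℕ} {G : Subgroup (Euc d →L[ℝ] Euc d)ˣ}
    (hG : ∀ g ∈ G, ∀ v, ‖(g : Euc d →L[ℝ] Euc d) v‖ = ‖v‖) (hdisc : DiscreteTopology G) :
    Finite G := by
  obtain ⟨ε, hε, h⟩ := exists_forall_le_norm_sub hdisc
  let f : G → (Euc d →L[ℝ] Euc d) := fun g => (g : (Euc d →L[ℝ] Euc d)ˣ)
  -- Left multiplication by the isometry `a` preserves the norm, so the gap at the identity becomes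
  -- a uniform separation of all of `G`. Together with total boundedness this gives finiteness
  -- without knowing that `G` is closed.
  have hf : ∀ a b : G, a ≠ b → ε ≤ dist (f a) (f b) := by
    intro a b hab
    rcases h (a⁻¹ * b : G) (a⁻¹ * b : G).2 with h1 | h1
    · exact absurd (inv_mul_eq_one.1 (Subtype.ext h1)) hab
    refine h1.trans ?_
    rw [dist_comm, dist_eq_norm]
    refine ContinuousLinearMap.opNorm_le_bound _ (norm_nonneg _) fun v => ?_
    rw [← hG a a.2]
    refine le_trans (le_of_eq ?_) ((f b - f a).le_opNorm v)
    congr 1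
    have h2 : (a : (Euc d →L[ℝ] Euc d)ˣ).val * (((a⁻¹ * b : G) : (Euc d →L[ℝ] Euc d)ˣ).val - 1)
        = f b - f a := by
      rw [mul_sub, mul_one, ← Units.val_mul]
      simp [f]
    rw [← h2]
    rfl
  have hinj : Function.Injective f := by
    intro a b hab
    by_contra hne
    have := hf a b hne
    rw [hab, dist_self] at this
    linarith
  have hbdd : TotallyBounded (range f) := by
    refine TotallyBounded.subset ?_ (isCompact_closedBall (0 : Euc d →L[ℝ] Euc d) 1).totallyBounded
    rintro _ ⟨g, rfl⟩
    rw [mem_closedBall_zero_iff]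
    exact ContinuousLinearMap.opNorm_le_bound _ zero_le_one fun v => by
      rw [one_mul]; exact (hG g g.2 v).le
  obtain ⟨t, htf, ht⟩ := Metric.totallyBounded_iff.1 hbdd (ε / 2) (by linarith)
  have h3 : ∀ g : G, ∃ y : t, dist (f g) y < ε / 2 := by
    intro g
    obtain ⟨y, hy, hy'⟩ := mem_iUnion₂.1 (ht ⟨g, rfl⟩)
    exact ⟨⟨y, hy⟩, hy'⟩
  choose y hy using h3
  have := htf.to_subtype
  refine Finite.of_injective y fun a b hab => ?_
  by_contra hne
  have h4 := hf a b hne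
  have h5 := dist_triangle_right (f a) (f b) (y a)
  have h6 := hy b
  rw [← hab] at h6
  linarith [hy a]

theorem exists_pow_eq_one {d : ℕ} {G : Subgroup (Euc d →L[ℝ] Euc d)ˣ}
    (hG : ∀ g ∈ G, ∀ v, ‖(g : Euc d →L[ℝ] Euc d) v‖ = ‖v‖) (hdisc : DiscreteTopology G) :
    ∃ N : ℕ, 0 < N ∧ ∀ g ∈ G, (g : Euc d →L[ℝ] Euc d) ^ N = 1 := by
  have := finite_of_discrete hG hdisc
  refine ⟨Nat.card G, Nat.card_pos, fun g hg => ?_⟩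
  have h1 := pow_card_eq_one' (x := (⟨g, hg⟩ : G))
  have h2 : g ^ Nat.card G = 1 := congrArg Subtype.val h1
  rw [← Units.val_pow_eq_pow_val, h2, Units.val_one]

/-! ### Second order expansion of the holonomy along small loops in a vector space. -/

section Holonomy

set_option maxSynthPendingDepth 3

variable {E : Type*} [NormedAddCommGroup E] [NormedSpace ℝ E]

/-- A closed curve in the plane spanned by `x` and `y` that encloses the area `1 / 60`. -/
def loop (x y : E) (t : ℝ) : E := (t - t ^ 2) • x + (t ^ 2 - t ^ 3) • y

/-- The velocity of `loop`. -/
def loopDeriv (x y : E) (t : ℝ) : E := (1 - 2 * t) • x + (2 * t - 3 * t ^ 2) • y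

theorem hasDerivAt_loop (x y : E) (t : ℝ) : HasDerivAt (loop x y) (loopDeriv x y t) t := by
  have h1 : HasDerivAt (fun t : ℝ => t - t ^ 2) (1 - 2 * t) t := by
    exact ((hasDerivAt_id t).sub (hasDerivAt_pow 2 t)).congr_deriv (by simp)
  have h2 : HasDerivAt (fun t : ℝ => t ^ 2 - t ^ 3) (2 * t - 3 * t ^ 2) t := by
    exact ((hasDerivAt_pow 2 t).sub (hasDerivAt_pow 3 t)).congr_deriv (by simp)
  exact (h1.smul_const x).add (h2.smul_const y)

theorem contDiff_loop (x y : E) {n : WithTop ℕ∞} : ContDiff ℝ n (loop x y) := by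
  unfold loop; fun_prop

@[simp] theorem loop_zero (x y : E) : loop x y 0 = 0 := by simp [loop]

@[simp] theorem loop_one (x y : E) : loop x y 1 = 0 := by simp [loop]

theorem norm_smul_add_smul_le {a b : ℝ} (ha : |a| ≤ 1) (hb : |b| ≤ 1) (x y : E) :
    ‖a • x + b • y‖ ≤ ‖x‖ + ‖y‖ := by
  refine (norm_add_le _ _).trans (add_le_add ?_ ?_)
  · rw [norm_smul]; exact mul_le_of_le_one_left (norm_nonneg x) ha
  · rw [norm_smul]; exact mul_le_of_le_one_left (norm_nonneg y) hb

theorem norm_loop_le (x y : E) {t : ℝ} (ht : t ∈ Icc (0 : ℝ) 1) : ‖loop x y t‖ ≤ ‖x‖ + ‖y‖ := by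
  obtain ⟨h0, h1⟩ := ht
  have h2 : t ^ 2 ≤ t := by nlinarith
  have h3 : t ^ 3 ≤ t ^ 2 := by nlinarith [sq_nonneg t]
  have h4 : 0 ≤ t ^ 3 := by positivity
  exact norm_smul_add_smul_le (abs_le.2 ⟨by linarith, by linarith⟩)
    (abs_le.2 ⟨by linarith, by linarith⟩) x y

theorem norm_loopDeriv_le (x y : E) {t : ℝ} (ht : t ∈ Icc (0 : ℝ) 1) :
    ‖loopDeriv x y t‖ ≤ ‖x‖ + ‖y‖ := by
  obtain ⟨h0, h1⟩ := ht
  exact norm_smul_add_smul_le (abs_le.2 ⟨by linarith, by linarith⟩)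
    (abs_le.2 ⟨by nlinarith, by nlinarith [sq_nonneg (3 * t - 1)]⟩) x y

/-- The curvature at a point of a connection with Christoffel form `Γ` (the second argument of
`Γ v w` is the direction) and derivative `DΓ` of the Christoffel form. -/
noncomputable def curvatureForm (Γ : E →L[ℝ] E →L[ℝ] E) (DΓ : E →L[ℝ] E →L[ℝ] E →L[ℝ] E)
    (x y : E) : E →L[ℝ] E :=
  (DΓ x).flip y - (DΓ y).flip x - (Γ.flip y) ∘L (Γ.flip x) + (Γ.flip x) ∘L (Γ.flip y)

theorem curvatureForm_apply (Γ : E →L[ℝ] E →L[ℝ] E) (DΓ : E →L[ℝ] E →L[ℝ] E →L[ℝ] E)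
    (x y v : E) : curvatureForm Γ DΓ x y v =
      DΓ x v y - DΓ y v x - Γ (Γ v x) y + Γ (Γ v y) x := by
  simp [curvatureForm]

/-- The quadratic form whose integral along a small loop is the second order part of the
holonomy. -/
noncomputable def holonomyIntegrand (Γ : E →L[ℝ] E →L[ℝ] E) (DΓ : E →L[ℝ] E →L[ℝ] E →L[ℝ] E)
    (v a b : E) : E := DΓ a v b - Γ (Γ v a) b

/-- The integrand is bilinear in position and velocity of the loop. The `x x` and `y y` coefficients
are exact derivatives and integrate to zero; the `x y` and `y x` coefficients integrate to `1 / 60`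
and `-1 / 60`, which leaves the antisymmetric part, the curvature. -/
theorem hasDerivAt_holonomyIntegrand_integral (Γ : E →L[ℝ] E →L[ℝ] E)
    (DΓ : E →L[ℝ] E →L[ℝ] E →L[ℝ] E) (x y v : E) :
    ∃ J : ℝ → E, J 0 = 0 ∧ J 1 = (1 / 60 : ℝ) • curvatureForm Γ DΓ x y v ∧
      ∀ t, HasDerivAt J (holonomyIntegrand Γ DΓ v (loop x y t) (loopDeriv x y t)) t := by
  refine ⟨fun t => ((t - t ^ 2) ^ 2 / 2) • holonomyIntegrand Γ DΓ v x x
    + ((t ^ 2 - t ^ 3) ^ 2 / 2) • holonomyIntegrand Γ DΓ v y y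
    + (2 / 3 * t ^ 3 - 5 / 4 * t ^ 4 + 3 / 5 * t ^ 5) • holonomyIntegrand Γ DΓ v x y
    + (1 / 3 * t ^ 3 - 3 / 4 * t ^ 4 + 2 / 5 * t ^ 5) • holonomyIntegrand Γ DΓ v y x,
    by simp, ?_, fun t => ?_⟩
  · rw [curvatureForm_apply]
    simp only [holonomyIntegrand]
    module
  · have h1 : HasDerivAt (fun t : ℝ => (t - t ^ 2) ^ 2 / 2) ((t - t ^ 2) * (1 - 2 * t)) t := by
      have := (((hasDerivAt_id t).sub (hasDerivAt_pow 2 t)).pow 2).div_const 2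
      refine this.congr_deriv ?_
      simp; ring
    have h2 : HasDerivAt (fun t : ℝ => (t ^ 2 - t ^ 3) ^ 2 / 2)
        ((t ^ 2 - t ^ 3) * (2 * t - 3 * t ^ 2)) t := by
      have := (((hasDerivAt_pow 2 t).sub (hasDerivAt_pow 3 t)).pow 2).div_const 2
      refine this.congr_deriv ?_
      simp; ring
    have h3 : ∀ p q r : ℝ, HasDerivAt (fun t : ℝ => p * t ^ 3 - q * t ^ 4 + r * t ^ 5)
        (p * (3 * t ^ 2) - q * (4 * t ^ 3) + r * (5 * t ^ 4)) t := by
      intro p q r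
      have := (((hasDerivAt_pow 3 t).const_mul p).sub ((hasDerivAt_pow 4 t).const_mul q)).add
        ((hasDerivAt_pow 5 t).const_mul r)
      exact this.congr_deriv (by simp)
    refine ((((h1.smul_const (holonomyIntegrand Γ DΓ v x x)).add
      (h2.smul_const (holonomyIntegrand Γ DΓ v y y))).add
      ((h3 (2 / 3) (5 / 4) (3 / 5)).smul_const (holonomyIntegrand Γ DΓ v x y))).add
      ((h3 (1 / 3) (3 / 4) (2 / 5)).smul_const (holonomyIntegrand Γ DΓ v y x))).congr_deriv ?_
    simp only [holonomyIntegrand, loop, loopDeriv, map_add, map_smul,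
      add_apply, smul_apply]
    module

theorem norm_apply₂_le {G : E →L[ℝ] E →L[ℝ] E} {v w : E} {k m l : ℝ} (hG : ‖G‖ ≤ k)
    (hv : ‖v‖ ≤ m) (hw : ‖w‖ ≤ l) : ‖G v w‖ ≤ k * m * l := by
  have hk : 0 ≤ k := (norm_nonneg _).trans hG
  have hm : 0 ≤ m := (norm_nonneg _).trans hv
  exact (G.le_opNorm₂ v w).trans (mul_le_mul (mul_le_mul hG hv (norm_nonneg _) hk) hw
    (norm_nonneg _) (by positivity))

/-- Second order expansion of the holonomy of a connection along small loops. -/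
theorem eventually_norm_holonomy_sub_le {Γ : E → E →L[ℝ] E →L[ℝ] E}
    {DΓ : E →L[ℝ] E →L[ℝ] E →L[ℝ] E} {u : E} (hΓ : HasFDerivAt Γ DΓ u) (x y : E) {ε : ℝ}
    (hε : 0 < ε) :
    ∀ᶠ s : ℝ in 𝓝[>] 0, ∀ W : ℝ → E, ContinuousOn W (Icc 0 1) →
      (∀ t ∈ Ico (0 : ℝ) 1, HasDerivWithinAt W
        (-Γ (u + s • loop x y t) (W t) (s • loopDeriv x y t)) (Ici t) t) →
      ‖W 1 - W 0 + s ^ 2 • (1 / 60 : ℝ) • curvatureForm (Γ u) DΓ x y (W 0)‖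
        ≤ ε * s ^ 2 * ‖W 0‖ := by
  set L : ℝ := ‖x‖ + ‖y‖ with hL
  have hL0 : 0 ≤ L := by positivity
  set K : ℝ := ‖Γ u‖ + 1 with hK
  have hK0 : 0 ≤ K := by positivity
  set K' : ℝ := ‖DΓ‖ + 1 with hK'
  have hK'0 : 0 ≤ K' := by positivity
  -- The error of linearizing `Γ` contributes at most `3 * δ * L ^ 2 * s ^ 2 * ‖W 0‖`, the `3`
  -- coming from the a priori bound on `W`. It receives half of `ε`; the terms of order `s ^ 3`
  -- receive the other half.
  set δ : ℝ := min 1 (ε / (6 * (L ^ 2 + 1))) with hδ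
  have hδ0 : 0 < δ := lt_min one_pos (by positivity)
  have hδ1 : δ ≤ 1 := min_le_left _ _
  have hδ2 : 3 * δ * L ^ 2 ≤ ε / 2 := by
    have h1 : δ ≤ ε / (6 * (L ^ 2 + 1)) := min_le_right _ _
    rw [le_div_iff₀ (by positivity)] at h1
    nlinarith
  -- The constant of the first order expansion `hZ`: one term from the variation of `Γ`, one from
  -- the variation of `W`.
  set C : ℝ := 3 * L ^ 2 * (K' + K ^ 2) with hC
  obtain ⟨ρ, hρ, hball⟩ := Metric.eventually_nhds_iff.1
    (hasFDerivAt_iff_isLittleO.1 hΓ |>.def hδ0)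
  have hsmall : ∀ c d : ℝ, 0 < d → ∀ᶠ s : ℝ in 𝓝[>] 0, s * c < d := by
    intro c d hd
    have h1 : Tendsto (fun s : ℝ => s * c) (𝓝[>] 0) (𝓝 0) := by
      simpa using (tendsto_id.mul_const c).mono_left (nhdsWithin_le_nhds (a := (0 : ℝ)))
    exact h1.eventually (gt_mem_nhds hd)
  filter_upwards [self_mem_nhdsWithin, hsmall L ρ hρ, hsmall (K * L) 1 one_pos,
    hsmall (K' * L) 1 one_pos, hsmall (3 * K' * K * L ^ 3 + K * C * L) (ε / 2) (half_pos hε)]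
    with s hs0 hs1 hs2 hs3 hs4 W hWc hW
  have hs0 : 0 < s := hs0
  set n : ℝ := ‖W 0‖ with hn
  have hn0 : 0 ≤ n := norm_nonneg _
  have hc : ∀ t ∈ Ico (0 : ℝ) 1, ‖loop x y t‖ ≤ L := fun t ht =>
    norm_loop_le x y (Ico_subset_Icc_self ht)
  have hc' : ∀ t ∈ Ico (0 : ℝ) 1, ‖loopDeriv x y t‖ ≤ L := fun t ht =>
    norm_loopDeriv_le x y (Ico_subset_Icc_self ht)
  have hr : ∀ t ∈ Ico (0 : ℝ) 1,
      ‖Γ (u + s • loop x y t) - Γ u - s • DΓ (loop x y t)‖ ≤ δ * (s * L) := by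
    intro t ht
    have h1 : ‖s • loop x y t‖ ≤ s * L := by
      rw [norm_smul, Real.norm_eq_abs, abs_of_pos hs0]
      exact mul_le_mul_of_nonneg_left (hc t ht) hs0.le
    have h2 := hball (y := u + s • loop x y t) (by
      rw [dist_self_add_left]; exact h1.trans_lt hs1)
    simp only [add_sub_cancel_left, map_smul] at h2
    exact h2.trans (mul_le_mul_of_nonneg_left h1 hδ0.le)
  have hDc : ∀ t ∈ Ico (0 : ℝ) 1, ‖DΓ (loop x y t)‖ ≤ ‖DΓ‖ * L := fun t ht =>
    (DΓ.le_opNorm _).trans (mul_le_mul_of_nonneg_left (hc t ht) (norm_nonneg _))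
  have hd : ∀ t ∈ Ico (0 : ℝ) 1, ‖Γ (u + s • loop x y t) - Γ u‖ ≤ s * (K' * L) := by
    intro t ht
    have h1 : Γ (u + s • loop x y t) - Γ u =
        (Γ (u + s • loop x y t) - Γ u - s • DΓ (loop x y t)) + s • DΓ (loop x y t) := by abel
    rw [h1]
    refine (norm_add_le _ _).trans ?_
    rw [norm_smul, Real.norm_eq_abs, abs_of_pos hs0]
    have h2 := hr t ht
    have h3 := mul_le_mul_of_nonneg_left (hDc t ht) hs0.le
    have h4 : δ * (s * L) ≤ 1 * (s * L) := mul_le_mul_of_nonneg_right hδ1 (by positivity)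
    rw [hK']
    linarith
  have hb : ∀ t ∈ Ico (0 : ℝ) 1, ‖Γ (u + s • loop x y t)‖ ≤ K := by
    intro t ht
    have h1 := norm_le_norm_sub_add (Γ (u + s • loop x y t)) (Γ u)
    linarith [hd t ht]
  have hsc' : ∀ t ∈ Ico (0 : ℝ) 1, ‖s • loopDeriv x y t‖ ≤ s * L := by
    intro t ht
    rw [norm_smul, Real.norm_eq_abs, abs_of_pos hs0]
    exact mul_le_mul_of_nonneg_left (hc' t ht) hs0.le
  -- The estimates bootstrap: Grönwall bounds `W`, since `s * K * L < 1` and `exp 1 < 3`; then `W -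
  -- W 0` is of order `s`, and its deviation from `-s • Γ u (W 0) (loop x y t)` is of order `s ^ 2`.
  have hW3 : ∀ t ∈ Icc (0 : ℝ) 1, ‖W t‖ ≤ 3 * n := by
    intro t ht
    have h1 := norm_le_gronwallBound_of_norm_deriv_right_le (δ := n) (K := 1) (ε := 0) hWc hW
      le_rfl (fun t ht => by
        rw [norm_neg]
        refine (norm_apply₂_le (hb t ht) le_rfl (hsc' t ht)).trans ?_
        have h2 := norm_nonneg (W t)
        nlinarith) t ht
    rw [gronwallBound_ε0] at h1
    have h2 : Real.exp (1 * (t - 0)) ≤ 3 :=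
      (Real.exp_le_exp.2 (by linarith [ht.2])).trans Real.exp_one_lt_three.le
    have h3 := mul_le_mul_of_nonneg_left h2 hn0
    linarith
  have hW0 : ∀ t ∈ Icc (0 : ℝ) 1, ‖W t - W 0‖ ≤ s * (3 * K * L) * n := by
    intro t ht
    have h1 := norm_image_sub_le_of_norm_deriv_right_le_segment hWc hW
      (C := s * (3 * K * L) * n) (fun t ht => by
        rw [norm_neg]
        exact (norm_apply₂_le (hb t ht) (hW3 t (Ico_subset_Icc_self ht)) (hsc' t ht)).trans
          (le_of_eq (by ring))) t ht
    refine h1.trans (mul_le_of_le_one_right (by positivity) (by linarith [ht.2]))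
  have hZ : ∀ t ∈ Icc (0 : ℝ) 1,
      ‖W t - W 0 + s • Γ u (W 0) (loop x y t)‖ ≤ s ^ 2 * C * n := by
    intro t ht
    have h1 := norm_image_sub_le_of_norm_deriv_right_le_segment
      (f := fun t => W t - W 0 + s • Γ u (W 0) (loop x y t))
      (f' := fun t => -Γ (u + s • loop x y t) (W t) (s • loopDeriv x y t)
        + s • Γ u (W 0) (loopDeriv x y t)) (C := s ^ 2 * C * n)
      ((hWc.sub continuousOn_const).add (continuousOn_const.smul
        ((Γ u (W 0)).continuous.comp (contDiff_loop x y (n := 0)).continuous).continuousOn))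
      (fun t ht => ((hW t ht).sub_const _).add
        ((((Γ u (W 0)).hasFDerivAt.comp_hasDerivAt t (hasDerivAt_loop x y t)).const_smul
          s).hasDerivWithinAt)) (fun t ht => by
        have h2 : -Γ (u + s • loop x y t) (W t) (s • loopDeriv x y t)
            + s • Γ u (W 0) (loopDeriv x y t)
            = -((Γ (u + s • loop x y t) - Γ u) (W t) (s • loopDeriv x y t)
              + Γ u (W t - W 0) (s • loopDeriv x y t)) := by
          simp only [sub_apply, map_sub, map_smul]
          module
        rw [h2, norm_neg]
        have ht' := Ico_subset_Icc_self ht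
        have h3 := norm_apply₂_le (hd t ht) (hW3 t ht') (hsc' t ht)
        have h4 := norm_apply₂_le (show ‖Γ u‖ ≤ K by rw [hK]; linarith) (hW0 t ht') (hsc' t ht)
        refine (norm_add_le _ _).trans ((add_le_add h3 h4).trans (le_of_eq ?_))
        rw [hC]; ring) t ht
    simp only [loop_zero, map_zero, smul_zero, sub_self, add_zero, sub_zero] at h1
    exact h1.trans (mul_le_of_le_one_right (by positivity) ht.2)
  obtain ⟨J, hJ0, hJ1, hJ⟩ := hasDerivAt_holonomyIntegrand_integral (Γ u) DΓ x y (W 0)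
  -- Adding `s ^ 2 • J` cancels the second order part of the derivative. At `t = 1` the linear term
  -- is zero because the loop is closed, so only the curvature term remains.
  have hY := norm_image_sub_le_of_norm_deriv_right_le_segment
    (f := fun t => W t - W 0 + s • Γ u (W 0) (loop x y t) + s ^ 2 • J t)
    (f' := fun t => -Γ (u + s • loop x y t) (W t) (s • loopDeriv x y t)
      + s • Γ u (W 0) (loopDeriv x y t)
      + s ^ 2 • holonomyIntegrand (Γ u) DΓ (W 0) (loop x y t) (loopDeriv x y t))
    (C := ε * s ^ 2 * n)
    (((hWc.sub continuousOn_const).add (continuousOn_const.smul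
      ((Γ u (W 0)).continuous.comp (contDiff_loop x y (n := 0)).continuous).continuousOn)).add
      (continuousOn_const.smul fun t _ => (hJ t).continuousAt.continuousWithinAt))
    (fun t ht => (((hW t ht).sub_const _).add
      ((((Γ u (W 0)).hasFDerivAt.comp_hasDerivAt t (hasDerivAt_loop x y t)).const_smul
        s).hasDerivWithinAt)).add ((hJ t).const_smul (s ^ 2)).hasDerivWithinAt) (fun t ht => by
      have ht' := Ico_subset_Icc_self ht
      have h2 : -Γ (u + s • loop x y t) (W t) (s • loopDeriv x y t)
          + s • Γ u (W 0) (loopDeriv x y t)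
          + s ^ 2 • holonomyIntegrand (Γ u) DΓ (W 0) (loop x y t) (loopDeriv x y t)
          = -((Γ (u + s • loop x y t) - Γ u - s • DΓ (loop x y t)) (W t) (s • loopDeriv x y t)
            + ((s • DΓ (loop x y t)) (W t - W 0) (s • loopDeriv x y t)
            + Γ u (W t - W 0 + s • Γ u (W 0) (loop x y t)) (s • loopDeriv x y t))) := by
        simp only [holonomyIntegrand, sub_apply, add_apply, smul_apply, map_sub, map_add, map_smul]
        module
      rw [h2, norm_neg]
      have h3 := norm_apply₂_le (hr t ht) (hW3 t ht') (hsc' t ht)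
      have h4 := norm_apply₂_le (show ‖s • DΓ (loop x y t)‖ ≤ s * (K' * L) by
        rw [norm_smul, Real.norm_eq_abs, abs_of_pos hs0]
        refine mul_le_mul_of_nonneg_left ((hDc t ht).trans ?_) hs0.le
        exact mul_le_mul_of_nonneg_right (by rw [hK']; linarith) hL0) (hW0 t ht') (hsc' t ht)
      have h5 := norm_apply₂_le (show ‖Γ u‖ ≤ K by rw [hK]; linarith) (hZ t ht') (hsc' t ht)
      refine (norm_add_le _ _).trans ((add_le_add h3 ((norm_add_le _ _).trans
        (add_le_add h4 h5))).trans ?_)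
      have h6 : δ * (s * L) * (3 * n) * (s * L) + (s * (K' * L) * (s * (3 * K * L) * n) * (s * L)
          + K * (s ^ 2 * C * n) * (s * L))
          = (3 * δ * L ^ 2 + s * (3 * K' * K * L ^ 3 + K * C * L)) * (s ^ 2 * n) := by ring
      rw [h6, mul_assoc ε]
      exact mul_le_mul_of_nonneg_right (by linarith) (by positivity)) 1 ⟨zero_le_one, le_rfl⟩
  simpa [hJ0, hJ1] using hY

end Holonomy

/-! ### Coframes and the flat connections they define. -/

section Coframes

variable {d : ℕ} {M : Type u} [TopologicalSpace M] [ChartedSpace (Euc d) M]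
  [IsManifold (𝓡 d) ∞ M]

/-- The `ℝ^d`-valued one-form `Φ` is differentiable at `q`. -/
def CoframeDiffAt (Φ : (p : M) → TangentSpace (𝓡 d) p →L[ℝ] Euc d) (q : M) : Prop :=
  MDifferentiableAt (𝓡 d) 𝓘(ℝ, Euc d →L[ℝ] Euc d) (fun x =>
    (Φ x ∘L (trivializationAt (Euc d) (TangentSpace (𝓡 d)) q).symmL ℝ x : Euc d →L[ℝ] Euc d)) q

variable {Φ : (p : M) → TangentSpace (𝓡 d) p →L[ℝ] Euc d} {q : M}

theorem symmL_trivialization_apply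
    {e : Trivialization (Euc d) (π (Euc d) (TangentSpace (𝓡 d) : M → Type))}
    [MemTrivializationAtlas e] {x : M} (hx : x ∈ e.baseSet) (v : TangentSpace (𝓡 d) x) :
    e.symmL ℝ x (e ⟨x, v⟩).2 = v := by
  have := Trivialization.symmL_continuousLinearMapAt (R := ℝ) e hx v
  rwa [Trivialization.continuousLinearMapAt_apply, e.coe_linearMapAt_of_mem hx] at this

theorem trivializationAt_self_apply (q : M) (v : TangentSpace (𝓡 d) q) :
    (trivializationAt (Euc d) (TangentSpace (𝓡 d)) q ⟨q, v⟩).2 = v :=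
  (tangentBundleCore (𝓡 d) M).coordChange_self (achart (Euc d) q) q (mem_chart_source _ q) v

theorem symmL_trivializationAt_self (q : M) (v : Euc d) :
    (trivializationAt (Euc d) (TangentSpace (𝓡 d)) q).symmL ℝ q v = v := by
  have h := symmL_trivialization_apply
    (e := trivializationAt (Euc d) (TangentSpace (𝓡 d)) q)
    (FiberBundle.mem_baseSet_trivializationAt' q) (v : TangentSpace (𝓡 d) q)
  exact (congrArg _ (trivializationAt_self_apply q v).symm).trans h

theorem CoframeDiffAt.mdifferentiableAt_apply (hΦ : CoframeDiffAt Φ q)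
    {σ : (x : M) → TangentSpace (𝓡 d) x}
    (hσ : MDifferentiableAt (𝓡 d) (𝓡 d).tangent
      (fun x => (⟨x, σ x⟩ : TangentBundle (𝓡 d) M)) q) :
    MDifferentiableAt (𝓡 d) 𝓘(ℝ, Euc d) (fun x => Φ x (σ x)) q := by
  have h1 := (mdifferentiableAt_section (𝓡 d) σ).1 hσ
  refine (MDifferentiableAt.clm_apply hΦ h1).congr_of_eventuallyEq ?_
  filter_upwards [(trivializationAt (Euc d) (TangentSpace (𝓡 d)) q).open_baseSet.mem_nhds
    (FiberBundle.mem_baseSet_trivializationAt' q)] with x hx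
  simp only [ContinuousLinearMap.comp_apply]
  rw [symmL_trivialization_apply hx]

/-- The connection for which the coframe `Φ` is parallel. -/
noncomputable def flatConn (Φ : (p : M) → TangentSpace (𝓡 d) p →L[ℝ] Euc d) : Conn d M :=
  fun σ x => (Φ x).inverse ∘L mvfderiv (𝓡 d) (fun q => Φ q (σ q)) x

theorem isCovariantDerivativeOn_flatConn {U : Set M} (hinv : ∀ x ∈ U, (Φ x).IsInvertible)
    (hΦ : ∀ x ∈ U, CoframeDiffAt Φ x) : IsCovariantDerivativeOn (Euc d) (flatConn Φ) U where
  add {σ σ' x} hσ hσ' hx := by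
    have h1 : (fun q => Φ q ((σ + σ') q)) = (fun q => Φ q (σ q)) + fun q => Φ q (σ' q) := by
      funext q; simp
    rw [flatConn, h1, mvfderiv_add ((hΦ x hx).mdifferentiableAt_apply hσ)
      ((hΦ x hx).mdifferentiableAt_apply hσ')]
    simp [flatConn, ContinuousLinearMap.comp_add]
  leibniz {σ g x} hσ hg hx := by
    have h1 : (fun q => Φ q ((g • σ) q)) = g • fun q => Φ q (σ q) := by
      funext q; simp
    rw [flatConn, h1, mvfderiv_smul hg ((hΦ x hx).mdifferentiableAt_apply hσ)]
    ext v
    simp [flatConn, hinv x hx]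


/-- The derivative of the components of a parallel field with respect to a coframe. -/
theorem IsParallelOn.hasDerivWithinAt {D : Conn d M} {V : ℝ → TangentBundle (𝓡 d) M} {J : Set ℝ}
    (hV : IsParallelOn D V J) {t : ℝ} (ht : t ∈ J) (hΦ : CoframeDiffAt Φ (V t).proj) :
    HasDerivWithinAt (fun τ => Φ (V τ).proj (V τ).snd)
      (mvfderiv (𝓡 d) (fun x => Φ x
          ((trivializationAt (Euc d) (TangentSpace (𝓡 d)) (V t).proj).symm x (V t).snd)) (V t).proj
          (mfderivWithin 𝓘(ℝ, ℝ) (𝓡 d) (fun τ => (V τ).proj) J t (1 : ℝ))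
        - Φ (V t).proj (D (fun x => (trivializationAt (Euc d) (TangentSpace (𝓡 d))
          (V t).proj).symm x (V t).snd) (V t).proj
          (mfderivWithin 𝓘(ℝ, ℝ) (𝓡 d) (fun τ => (V τ).proj) J t (1 : ℝ)))) J t := by
  obtain ⟨hγ, hpar⟩ := hV
  set e := trivializationAt (Euc d) (TangentSpace (𝓡 d)) (V t).proj with he
  have hqe : (V t).proj ∈ e.baseSet := FiberBundle.mem_baseSet_trivializationAt' _
  set γ : ℝ → M := fun τ => (V τ).proj with hγdef
  set v : Euc d := (V t).snd with hv
  -- In the trivialization at `(V t).proj`, `Φ (V τ)` is the product of `A (γ τ)` with the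
  -- representative of `V τ`, so the product rule applies. The derivative of `A` is the derivative
  -- of `Φ` on the field with constant representative, the one used in `IsParallelOn`.
  let A : M → Euc d →L[ℝ] Euc d := fun x => Φ x ∘L e.symmL ℝ x
  have hAdef : ∀ x (v : Euc d), A x v = Φ x (e.symmL ℝ x v) := fun x v => rfl
  set w := mfderivWithin 𝓘(ℝ, ℝ) (𝓡 d) γ J t (1 : ℝ) with hw
  have hγt : MDifferentiableWithinAt 𝓘(ℝ, ℝ) (𝓡 d) γ J t :=
    (hγ t ht).mdifferentiableWithinAt (by simp)
  obtain ⟨A', hA'⟩ : ∃ A' : TangentSpace (𝓡 d) (V t).proj →L[ℝ] (Euc d →L[ℝ] Euc d),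
      HasMFDerivAt (𝓡 d) 𝓘(ℝ, Euc d →L[ℝ] Euc d) A (V t).proj A' :=
    ⟨_, MDifferentiableAt.hasMFDerivAt hΦ⟩
  have h0 : HasMFDerivWithinAt 𝓘(ℝ, ℝ) 𝓘(ℝ, Euc d →L[ℝ] Euc d) (A ∘ γ) J t
      (A' ∘L mfderivWithin 𝓘(ℝ, ℝ) (𝓡 d) γ J t) :=
    HasMFDerivAt.comp_hasMFDerivWithinAt t hA' hγt.hasMFDerivWithinAt
  have h1 : HasDerivWithinAt (fun τ => A (γ τ)) (A' w) J t := by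
    have h01 : HasFDerivWithinAt (fun τ => A (γ τ))
        (A' ∘L mfderivWithin 𝓘(ℝ, ℝ) (𝓡 d) γ J t : ℝ →L[ℝ] Euc d →L[ℝ] Euc d) J t :=
      h0.hasFDerivWithinAt
    exact h01.hasDerivWithinAt
  have h2 := h1.clm_apply (hpar t ht)
  have hvt : (e (V t)).2 = v := trivializationAt_self_apply (V t).proj (V t).snd
  have hev : (fun x => Φ x (e.symm x v)) =ᶠ[𝓝 (V t).proj] fun x => A x v := by
    filter_upwards [e.open_baseSet.mem_nhds hqe] with x hx
    rw [hAdef, e.symmL_apply hx]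
  have h3 : mvfderiv (𝓡 d) (fun x => Φ x (e.symm x v)) (V t).proj w = A' w v := by
    have h4 : HasMFDerivAt (𝓡 d) 𝓘(ℝ, Euc d) (fun x => A x v) (V t).proj
        ((ContinuousLinearMap.apply ℝ (Euc d) v) ∘L A') :=
      HasMFDerivAt.comp (V t).proj (ContinuousLinearMap.apply ℝ (Euc d) v).hasMFDerivAt hA'
    simp only [mvfderiv, (h4.congr_of_eventuallyEq hev).mfderiv]
    rfl
  have hAt : ∀ v, A (γ t) v = Φ (V t).proj v := fun v =>
    congrArg (Φ (V t).proj) (symmL_trivializationAt_self (V t).proj v)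
  refine (h2.congr_of_eventuallyEq ?_ ?_).congr_deriv ?_
  · filter_upwards [hγt.continuousWithinAt.preimage_mem_nhdsWithin
      (e.open_baseSet.mem_nhds hqe)] with τ hτ
    rw [hAdef]
    exact congrArg _ (symmL_trivialization_apply hτ (V τ).snd).symm
  · rw [hAdef]
    exact congrArg _ (symmL_trivialization_apply hqe (V t).snd).symm
  · rw [h3, sub_eq_add_neg]
    exact congrArg₂ (· + ·) (congrArg (A' w) hvt)
      ((hAt _).trans (map_neg (Φ (V t).proj) _))

end Coframes

/-! ### The Levi-Civita connection of a body with discrete defects. -/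

section LeviCivita

variable {d : ℕ} {M : Type u} [TopologicalSpace M] [ChartedSpace (Euc d) M]
  [IsManifold (𝓡 d) ∞ M] {𝒲 : Archetype d}

theorem UniformBody.coframeDiffAt (B : UniformBody.{u, w} M 𝒲) {α : B.ι} {q : M}
    (hq : q ∈ B.U α) : CoframeDiffAt (B.P α) q := by
  have h1 := ((B.P_smooth α).contMDiffAt ((B.isOpen_U α).mem_nhds hq)).mdifferentiableAt (by simp)
  have h2 := ((mdifferentiableAt_hom_bundle _).1 h1).2
  refine h2.congr_of_eventuallyEq (Eventually.of_forall fun x => ?_)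
  ext v
  simp [ContinuousLinearMap.inCoordinates]

theorem UniformBody.exists_transition (B : UniformBody.{u, w} M 𝒲) {α β : B.ι} {p : M}
    (hα : p ∈ B.U α) (hβ : p ∈ B.U β) :
    ∃ g ∈ symmetryGroup 𝒲, ∀ v : TangentSpace (𝓡 d) p,
      (g : Euc d →L[ℝ] Euc d) (B.P α p v) = B.P β p v := by
  obtain ⟨e, he⟩ := B.P_invertible β p hβ
  obtain ⟨f, hf⟩ := B.P_invertible α p hα
  have h1 := B.W_eq β p hβ
  have h2 := B.W_eq α p hα
  rw [← he] at h1 ⊢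
  rw [← hf] at h2 ⊢
  rw [ContinuousLinearMap.inverse_equiv] at h1 h2
  refine ⟨ContinuousLinearEquiv.unitsEquiv ℝ (Euc d) |>.symm (f.symm.trans e), fun C => ?_,
    fun v => ?_⟩
  -- Evaluating `W p` at `C ∘ P β p` gives `𝒲 C` through `β` and `𝒲 (C ∘ g)` through `α`.
  · have h3 := h1 (C ∘L (e : TangentSpace (𝓡 d) p →L[ℝ] Euc d))
    rw [h2 (C ∘L (e : TangentSpace (𝓡 d) p →L[ℝ] Euc d))] at h3
    have h5 : (C ∘L (e : TangentSpace (𝓡 d) p →L[ℝ] Euc d)) ∘L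
        (e.symm : Euc d →L[ℝ] TangentSpace (𝓡 d) p) = C := by
      ext v i
      simp
    rw [h5] at h3
    exact h3
  · show e (f.symm (f v)) = e v
    simp

theorem UniformBody.U_subset_carrier (B : UniformBody.{u, w} M 𝒲) (α : B.ι) :
    B.U α ⊆ B.carrier := by
  rw [← B.iUnion_U]; exact subset_iUnion _ α

omit [IsManifold (𝓡 d) ∞ M] in
theorem mvfderiv_inner {f g : M → Euc d} {x : M} (hf : MDifferentiableAt (𝓡 d) 𝓘(ℝ, Euc d) f x)
    (hg : MDifferentiableAt (𝓡 d) 𝓘(ℝ, Euc d) g x) (v : TangentSpace (𝓡 d) x) :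
    mvfderiv (𝓡 d) (fun q => (inner ℝ (f q) (g q) : ℝ)) x v
      = inner ℝ (mvfderiv (𝓡 d) f x v) (g x) + inner ℝ (f x) (mvfderiv (𝓡 d) g x v) := by
  have h1 : HasMFDerivAt 𝓘(ℝ, Euc d × Euc d) 𝓘(ℝ, ℝ) (fun z : Euc d × Euc d => (inner ℝ z.1 z.2 : ℝ))
      (f x, g x) _ := ((isBoundedBilinearMap_inner (𝕜 := ℝ) (E := Euc d)).hasFDerivAt
        (f x, g x)).hasMFDerivAt
  have h0 : HasMFDerivAt (𝓡 d) 𝓘(ℝ, Euc d × Euc d) (fun q => (f q, g q)) x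
      ((mfderiv (𝓡 d) 𝓘(ℝ, Euc d) f x).prod (mfderiv (𝓡 d) 𝓘(ℝ, Euc d) g x)) :=
    ⟨hf.continuousAt.prodMk hg.continuousAt, hf.hasMFDerivAt.2.prodMk hg.hasMFDerivAt.2⟩
  have h2 := HasMFDerivAt.comp (f := fun q => (f q, g q)) x h1 h0
  have h3 : mfderiv (𝓡 d) 𝓘(ℝ, ℝ) (fun q => (inner ℝ (f q) (g q) : ℝ)) x = _ := h2.mfderiv
  simp only [mvfderiv, h3]
  rw [add_comm]
  rfl

/-- The transposition of the last two slots is `(12)(13)(12) = (13)(12)(13)`; it acts by `-1`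
according to the first expression and by `+1` according to the second. -/
theorem skew_symm_eq_zero {V : Type*} (S : V → V → V → ℝ) (h1 : ∀ a b c, S a b c = S b a c)
    (h2 : ∀ a b c, S a b c = - S c b a) (a b c : V) : S a b c = 0 := by
  have h3 : S a b c = - S a b c := by
    conv_lhs => rw [h2, h1, h2, neg_neg, h1, h2, h1]
  linarith

/-- The reference maps are parallel for the Levi-Civita connection of a body with discrete
defects. -/
theorem DefectBody.eq_flatConn (B : DefectBody.{u, w} M 𝒲) (h𝒲 : IsUndistorted 𝒲)
    {D : Conn d M} (hD : B.IsLeviCivita D) {α : B.ι} {x : M} (hx : x ∈ B.U α)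
    {σ : (q : M) → TangentSpace (𝓡 d) q}
    (hσ : MDifferentiableAt (𝓡 d) (𝓡 d).tangent
      (fun q => (⟨q, σ q⟩ : TangentBundle (𝓡 d) M)) x) :
    D σ x = flatConn (B.P α) σ x := by
  have hc := hD.isCovariantDerivativeOn.mono (B.U_subset_carrier α)
  have hf := isCovariantDerivativeOn_flatConn (B.P_invertible α)
    fun x hx => B.coframeDiffAt (α := α) hx
  have hcx := B.U_subset_carrier α hx
  set P := B.P α with hP
  obtain ⟨e, he⟩ := B.P_invertible α x hx
  have hinj : ∀ v, P x v = 0 → v = 0 := by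
    intro v hv
    rw [hP, ← he] at hv
    simpa using hv
  -- The uniqueness argument for Levi-Civita connections. The difference tensor `T` is symmetric
  -- because `D` is torsion-free and `P` is closed (`hS1`), and skew because both connections
  -- preserve the metric (`hS2`); hence it vanishes.
  let T := IsCovariantDerivativeOn.difference hc hf x
  have hT : ∀ {τ : (q : M) → TangentSpace (𝓡 d) q}, MDifferentiableAt (𝓡 d) (𝓡 d).tangent
      (fun q => (⟨q, τ q⟩ : TangentBundle (𝓡 d) M)) x → ∀ v,
      P x (T (τ x) v) = P x (D τ x v) - mvfderiv (𝓡 d) (fun q => P q (τ q)) x v := by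
    intro τ hτ v
    have h1 := IsCovariantDerivativeOn.difference_apply hc hf hx hτ
    have h2 : T (τ x) v = D τ x v - flatConn P τ x v := by rw [h1]; rfl
    rw [h2, map_sub, flatConn, ContinuousLinearMap.comp_apply,
      (B.P_invertible α x hx).self_apply_inverse]
  have hext : ∀ a : TangentSpace (𝓡 d) x, MDifferentiableAt (𝓡 d) (𝓡 d).tangent
      (fun q => (⟨q, FiberBundle.extend (Euc d) a q⟩ : TangentBundle (𝓡 d) M)) x := fun a =>
    FiberBundle.mdifferentiableAt_extend ..
  have hS1 : ∀ a b : TangentSpace (𝓡 d) x, P x (T a b) = P x (T b a) := by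
    intro a b
    have h1 := hT (hext a) b
    have h2 := hT (hext b) a
    have h3 := hD.torsion_free x hcx _ _ (hext a) (hext b)
    have h4 := B.P_closed α x hx _ _ (hext a) (hext b)
    rw [← h3, ← hP] at h4
    simp only [FiberBundle.extend_apply_self, map_sub] at h1 h2 h4
    rw [h1, h2]
    rw [← sub_eq_zero, ← h4]
    abel
  have hS2 : ∀ a v b : TangentSpace (𝓡 d) x,
      (inner ℝ (P x (T a v)) (P x b) : ℝ) = - inner ℝ (P x (T b v)) (P x a) := by
    intro a v b
    have h1 := hT (hext a) v
    have h2 := hT (hext b) v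
    have h3 := hD.metric_compatible x hcx v _ _ (hext a) (hext b)
    rw [B.metric_eq h𝒲 hx, B.metric_eq h𝒲 hx] at h3
    -- The derivative of the metric needs the formula through the fixed `α` on a neighborhood of
    -- `x`, because `B.metric` chooses an index separately at each point.
    have h4 : (fun q => B.metric q (FiberBundle.extend (Euc d) a q)
        (FiberBundle.extend (Euc d) b q)) =ᶠ[𝓝 x] fun q =>
        inner ℝ (P q (FiberBundle.extend (Euc d) a q)) (P q (FiberBundle.extend (Euc d) b q)) := by
      filter_upwards [(B.isOpen_U α).mem_nhds hx] with q hq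
      rw [B.metric_eq h𝒲 hq]
    have h5 := mvfderiv_inner ((B.coframeDiffAt hx).mdifferentiableAt_apply (hext a))
      ((B.coframeDiffAt hx).mdifferentiableAt_apply (hext b)) v
    have h6 : mvfderiv (𝓡 d) (fun q => B.metric q (FiberBundle.extend (Euc d) a q)
        (FiberBundle.extend (Euc d) b q)) x v = mvfderiv (𝓡 d) (fun q =>
        (inner ℝ (P q (FiberBundle.extend (Euc d) a q)) (P q (FiberBundle.extend (Euc d) b q)) : ℝ))
        x v := by
      simp only [mvfderiv, h4.mfderiv_eq]
      rfl
    rw [h6, h5] at h3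
    simp only [FiberBundle.extend_apply_self] at h1 h2 h3
    rw [h1, h2, inner_sub_left, inner_sub_left, real_inner_comm (P x a), real_inner_comm (P x a)]
    linarith
  have hT0 : ∀ a v : TangentSpace (𝓡 d) x, T a v = 0 := by
    intro a v
    refine hinj _ (inner_self_eq_zero (𝕜 := ℝ).1 ?_)
    exact skew_symm_eq_zero (fun a b c : TangentSpace (𝓡 d) x =>
      (inner ℝ (P x (T a b)) (P x c) : ℝ)) (fun a b c => by rw [hS1]) hS2 a v (T a v)
  have h1 := IsCovariantDerivativeOn.difference_apply hc hf hx hσ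
  have h2 : T (σ x) = 0 := ContinuousLinearMap.ext fun v => hT0 _ v
  exact sub_eq_zero.1 (h1.symm.trans h2)

end LeviCivita

/-! ### Disclination contents as symmetries of the archetype. -/

section Disclinations

variable {d : ℕ} {M : Type u} [TopologicalSpace M] [ChartedSpace (Euc d) M]
  [IsManifold (𝓡 d) ∞ M] {𝒲 : Archetype d}

/-- The Levi-Civita connection is the one for which `P α` is parallel, so the components have zero
right derivative; across the breakpoints of the subdivision, continuity suffices. -/
theorem DefectBody.apply_parallel_eq (B : DefectBody.{u, w} M 𝒲) (h𝒲 : IsUndistorted 𝒲)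
    {D : Conn d M} (hD : B.IsLeviCivita D) {α : B.ι} {V : ℝ → TangentBundle (𝓡 d) M}
    (hV : Piecewise (IsParallelOn D V)) {a b : ℝ} (ha : 0 ≤ a) (hab : a ≤ b) (hb : b ≤ 1)
    (hU : ∀ t ∈ Icc a b, (V t).proj ∈ B.U α) :
    B.P α (V b).proj (V b).snd = B.P α (V a).proj (V a).snd := by
  have h1 := hV.hasDerivWithinAt (f := fun τ => B.P α (V τ).proj (V τ).snd)
    (f' := fun _ => 0) ha hb (fun c e hce hQ t ht ht' => by
      have h2 := hQ.hasDerivWithinAt ht (B.coframeDiffAt (hU t ht'))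
      refine h2.congr_deriv ?_
      have h3 := B.eq_flatConn h𝒲 hD (hU t ht') (σ := fun x => (trivializationAt (Euc d)
        (TangentSpace (𝓡 d)) (V t).proj).symm x (V t).snd) (by
          have h4 := FiberBundle.mdifferentiableAt_extend (𝓡 d) (Euc d) (V t).snd
          simpa only [FiberBundle.extend, trivializationAt_self_apply] using h4)
      rw [h3, flatConn, ContinuousLinearMap.comp_apply,
        (B.P_invertible α _ (hU t ht')).self_apply_inverse, sub_self])
  exact constant_of_has_deriv_right_zero h1.1 h1.2 b ⟨hab, le_rfl⟩

omit [IsManifold (𝓡 d) ∞ M] in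
theorem IsClosedCurve.continuousOn {γ : ℝ → M} {p : M} (h : IsClosedCurve d γ p) :
    ContinuousOn γ (Icc 0 1) :=
  h.2.2.continuousOn le_rfl le_rfl fun _ _ _ hQ t ht _ => hQ.continuousOn t ht

/-- Disclination contents are, in terms of the reference maps, symmetries of the archetype. -/
theorem DefectBody.exists_symmetry (B : DefectBody.{u, w} M 𝒲) (h𝒲 : IsUndistorted 𝒲)
    {D : Conn d M} (hD : B.IsLeviCivita D) {γ : ℝ → M} {p : M} (hγ : IsClosedCurve d γ p)
    (hγB : MapsTo γ (Icc 0 1) B.carrier) {c : TangentSpace (𝓡 d) p →L[ℝ] TangentSpace (𝓡 d) p}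
    (hc : IsParallelTransport D γ c) {α : B.ι} (hα : p ∈ B.U α) :
    ∃ g ∈ symmetryGroup 𝒲, ∀ v, B.P α p (c v) = (g : Euc d →L[ℝ] Euc d) (B.P α p v) := by
  obtain ⟨τ, h0, hmono, ⟨N, hN⟩, hsub⟩ := exists_monotone_Icc_subset_open_cover_unitInterval
    (c := fun β => (fun t : unitInterval => γ t) ⁻¹' B.U β)
    (fun β => (B.isOpen_U β).preimage hγ.continuousOn.domRestrict) (fun t _ => by
      have h1 := hγB t.2
      rw [← B.iUnion_U] at h1
      simpa using h1)
  choose β hβ using hsub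
  have hβ' : ∀ n, ∀ t ∈ Icc (τ n : ℝ) (τ (n + 1)), γ t ∈ B.U (β n) := by
    intro n t ht
    exact hβ n (show (⟨t, (τ n).2.1.trans ht.1, ht.2.trans (τ (n + 1)).2.2⟩ : unitInterval)
      ∈ Icc (τ n) (τ (n + 1)) from ht)
  have hττ : ∀ n, (τ n : ℝ) ≤ τ (n + 1) := fun n => hmono (Nat.le_succ n)
  -- The element `g` is chosen before `V`: it depends only on the chain of reference neighborhoods
  -- along `γ`, so that one `g` serves all initial vectors.
  have key : ∀ n, ∃ g ∈ symmetryGroup 𝒲, ∀ V : ℝ → TangentBundle (𝓡 d) M,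
      (∀ t ∈ Icc (0 : ℝ) 1, (V t).proj = γ t) → Piecewise (IsParallelOn D V) →
      B.P (β n) (V (τ n)).proj (V (τ n)).snd
        = (g : Euc d →L[ℝ] Euc d) (B.P α (V 0).proj (V 0).snd) := by
    intro n
    induction n with
    | zero =>
      have h1 : γ 0 ∈ B.U α := by rw [hγ.1]; exact hα
      have h2 : γ 0 ∈ B.U (β 0) := by
        have := hβ' 0 (τ 0) ⟨le_rfl, hττ 0⟩
        rwa [h0] at this
      obtain ⟨g, hg, hgP⟩ := B.exists_transition h1 h2
      refine ⟨g, hg, fun V hV _ => ?_⟩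
      have h3 := hV 0 ⟨le_rfl, zero_le_one⟩
      rw [← h3] at hgP
      rw [h0]
      exact (hgP (V 0).snd).symm
    | succ n ih =>
      obtain ⟨g, hg, hgP⟩ := ih
      have h1 := hβ' n (τ (n + 1)) ⟨hττ n, le_rfl⟩
      have h2 := hβ' (n + 1) (τ (n + 1)) ⟨le_rfl, hττ (n + 1)⟩
      obtain ⟨k, hk, hkP⟩ := B.exists_transition h1 h2
      refine ⟨k * g, mul_mem hk hg, fun V hV hVp => ?_⟩
      have h3 := hV (τ (n + 1)) (τ (n + 1)).2
      rw [← h3] at hkP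
      rw [← hkP, B.apply_parallel_eq h𝒲 hD hVp (τ n).2.1 (hττ n) (τ (n + 1)).2.2 (fun t ht => by
        rw [hV t ⟨(τ n).2.1.trans ht.1, ht.2.trans (τ (n + 1)).2.2⟩]; exact hβ' n t ht),
        hgP V hV hVp]
      rfl
  obtain ⟨g, hg, hgP⟩ := key N
  have hτN : (τ N : ℝ) = 1 := by rw [hN N le_rfl]; rfl
  have h1 : p ∈ B.U (β N) := by
    have := hβ' N (τ N) ⟨le_rfl, hττ N⟩
    rwa [hτN, hγ.2.1] at this
  obtain ⟨k, hk, hkP⟩ := B.exists_transition h1 hα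
  refine ⟨k * g, mul_mem hk hg, fun v => ?_⟩
  obtain ⟨V, hV, hV0, hV1, hVp⟩ := hc v
  have h2 := hgP V hV hVp
  rw [hτN, hV0, hV1] at h2
  rw [← hkP, h2]
  rfl

theorem exists_disclination_gap (h𝒲 : IsUndistorted 𝒲)
    (hdisc : DiscreteTopology (symmetryGroup 𝒲)) :
    ∃ ε : ℝ, 0 < ε ∧
      ∀ (M : Type u) [TopologicalSpace M] [ChartedSpace (Euc d) M] [IsManifold (𝓡 d) ∞ M]
        (B : DefectBody.{u, w} M 𝒲) (γ : ℝ → M) (p : M)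
        (c : TangentSpace (𝓡 d) p →L[ℝ] TangentSpace (𝓡 d) p),
        B.IsDisclinationContent γ c →
          c = ContinuousLinearMap.id ℝ (TangentSpace (𝓡 d) p) ∨
          ∀ α : B.ι, p ∈ B.U α →
            ε ≤ ‖(B.P α p ∘L c ∘L (B.P α p).inverse) - ContinuousLinearMap.id ℝ (Euc d)‖ := by
  obtain ⟨ε, hε, h⟩ := exists_forall_le_norm_sub hdisc
  refine ⟨ε, hε, ?_⟩
  intro M _ _ _ B γ p c ⟨hγ, hγB, D, hD, hc⟩
  by_cases hid : c = ContinuousLinearMap.id ℝ (TangentSpace (𝓡 d) p)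
  · exact Or.inl hid
  refine Or.inr fun α hα => ?_
  obtain ⟨g, hg, hgP⟩ := B.exists_symmetry h𝒲 hD hγ hγB hc hα
  have hinv := B.P_invertible α p hα
  have h1 : B.P α p ∘L c ∘L (B.P α p).inverse = (g : Euc d →L[ℝ] Euc d) := by
    ext1 v
    simp only [ContinuousLinearMap.comp_apply]
    rw [hgP, hinv.self_apply_inverse]
  rw [h1]
  refine (h g hg).resolve_left fun h2 => hid ?_
  ext1 v
  have h3 := hgP v
  rw [h2] at h3
  obtain ⟨e, he⟩ := hinv
  rw [← he] at h3
  exact e.injective h3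

end Disclinations

/-! ### Christoffel symbols and parallel fields in a chart. -/

section ChartCoframe

variable {d : ℕ} {M : Type u} [TopologicalSpace M] [ChartedSpace (Euc d) M]
  [IsManifold (𝓡 d) ∞ M]

/-- The trivialization of the tangent bundle given by the chart at `p`. -/
noncomputable abbrev chartTriv (p : M) :
    Trivialization (Euc d) (π (Euc d) (TangentSpace (𝓡 d) : M → Type)) :=
  trivializationAt (Euc d) (TangentSpace (𝓡 d)) p

/-- The coframe given by the chart at `p`. -/
noncomputable def chartCoframe (p x : M) : TangentSpace (𝓡 d) x →L[ℝ] Euc d :=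
  (chartTriv p).continuousLinearMapAt ℝ x

/-- The frame given by the chart at `p`. -/
noncomputable def chartFrame (p x : M) : Euc d →L[ℝ] TangentSpace (𝓡 d) x :=
  (chartTriv p).symmL ℝ x

variable {p x : M}

theorem chartCoframe_chartFrame (hx : x ∈ (chartTriv (d := d) p).baseSet) (v : Euc d) :
    chartCoframe p x (chartFrame p x v) = v :=
  Trivialization.continuousLinearMapAt_symmL _ hx v

theorem chartFrame_chartCoframe (hx : x ∈ (chartTriv (d := d) p).baseSet)
    (v : TangentSpace (𝓡 d) x) : chartFrame p x (chartCoframe p x v) = v :=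
  Trivialization.symmL_continuousLinearMapAt _ hx v

theorem isInvertible_chartCoframe (hx : x ∈ (chartTriv (d := d) p).baseSet) :
    (chartCoframe (d := d) p x).IsInvertible :=
  ContinuousLinearMap.IsInvertible.of_inverse (g := chartFrame p x)
    (ContinuousLinearMap.ext fun v => chartCoframe_chartFrame hx v)
    (ContinuousLinearMap.ext fun v => chartFrame_chartCoframe hx v)

theorem chartCoframe_eq_mfderiv (hx : x ∈ (chartTriv (d := d) p).baseSet) :
    chartCoframe (d := d) p x = mfderiv (𝓡 d) 𝓘(ℝ, Euc d) (extChartAt (𝓡 d) p) x :=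
  TangentBundle.continuousLinearMapAt_trivializationAt
    (by rwa [TangentBundle.trivializationAt_baseSet] at hx)

theorem chartCoframe_self (p : M) (v : TangentSpace (𝓡 d) p) : chartCoframe p p v = v := by
  rw [chartCoframe, Trivialization.continuousLinearMapAt_apply,
    Trivialization.coe_linearMapAt_of_mem _ (FiberBundle.mem_baseSet_trivializationAt' p)]
  exact trivializationAt_self_apply p v

theorem coframeDiffAt_chartCoframe (hx : x ∈ (chartTriv (d := d) p).baseSet) :
    CoframeDiffAt (d := d) (chartCoframe p) x := by
  have hx' : x ∈ (chartTriv (d := d) x).baseSet := FiberBundle.mem_baseSet_trivializationAt' x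
  refine (mdifferentiableAt_coordChangeL (IB := 𝓡 d) hx' hx).congr_of_eventuallyEq ?_
  filter_upwards [(chartTriv x).open_baseSet.mem_nhds hx', (chartTriv p).open_baseSet.mem_nhds hx]
    with y hy hy'
  ext1 v
  simp only [ContinuousLinearMap.comp_apply, ContinuousLinearEquiv.coe_coe]
  rw [Trivialization.coordChangeL_apply _ _ ⟨hy, hy'⟩, Trivialization.symmL_apply _ hy,
    chartCoframe, Trivialization.continuousLinearMapAt_apply,
    Trivialization.coe_linearMapAt_of_mem _ hy']

theorem contMDiffOn_chartFrame (p : M) (v : Euc d) :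
    ContMDiffOn (𝓡 d) (𝓡 d).tangent ∞
      (fun x => (⟨x, chartFrame p x v⟩ : TangentBundle (𝓡 d) M)) (chartTriv (d := d) p).baseSet := by
  refine ((chartTriv p).contMDiffOn_section_baseSet_iff (IB := 𝓡 d) (n := ∞)).2 ?_
  refine (contMDiffOn_const (c := v)).congr fun x hx => ?_
  have := chartCoframe_chartFrame hx v
  rwa [chartCoframe, Trivialization.continuousLinearMapAt_apply,
    Trivialization.coe_linearMapAt_of_mem _ hx] at this

theorem mdifferentiableAt_chartFrame (hx : x ∈ (chartTriv (d := d) p).baseSet) (v : Euc d) :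
    MDifferentiableAt (𝓡 d) (𝓡 d).tangent
      (fun x => (⟨x, chartFrame p x v⟩ : TangentBundle (𝓡 d) M)) x :=
  ((contMDiffOn_chartFrame p v).contMDiffAt
    ((chartTriv p).open_baseSet.mem_nhds hx)).mdifferentiableAt (by simp)

variable {D : Conn d M}

theorem isCovariantDerivativeOn_chart (p : M) : IsCovariantDerivativeOn (Euc d)
    (flatConn (chartCoframe (d := d) p)) (chartTriv (d := d) p).baseSet :=
  isCovariantDerivativeOn_flatConn (fun _ hx => isInvertible_chartCoframe hx)
    fun _ hx => coframeDiffAt_chartCoframe hx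

/-- The difference between `D` and the connection with parallel coordinate fields. -/
noncomputable def chartDifference (hD : IsCovariantDerivativeOn (Euc d) D univ) (p x : M) :
    TangentSpace (𝓡 d) x →L[ℝ] TangentSpace (𝓡 d) x →L[ℝ] TangentSpace (𝓡 d) x :=
  IsCovariantDerivativeOn.difference (hD.mono (subset_univ _))
    (isCovariantDerivativeOn_chart p) x

/-- The Christoffel symbols of `D` in the chart at `p`. -/
noncomputable def christoffel (hD : IsCovariantDerivativeOn (Euc d) D univ) (p x : M) :
    Euc d →L[ℝ] Euc d →L[ℝ] Euc d :=
  LinearMap.toContinuousLinearMap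
    { toFun := fun v => chartCoframe p x ∘L chartDifference hD p x (chartFrame p x v) ∘L
        chartFrame p x
      map_add' := fun v w => by ext1 z; simp
      map_smul' := fun c v => by ext1 z; simp }

theorem christoffel_apply (hD : IsCovariantDerivativeOn (Euc d) D univ) (p x : M) (v w : Euc d) :
    christoffel hD p x v w =
      chartCoframe p x (chartDifference hD p x (chartFrame p x v) (chartFrame p x w)) := rfl

/-- The coordinate formula `∇_w σ = dσ(w) + Γ(σ, w)`. It holds because the Christoffel form is by
construction the difference between `D` and the flat connection of the chart. -/
theorem chartCoframe_conn (hD : IsCovariantDerivativeOn (Euc d) D univ)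
    (hx : x ∈ (chartTriv (d := d) p).baseSet) {σ : (q : M) → TangentSpace (𝓡 d) q}
    (hσ : MDifferentiableAt (𝓡 d) (𝓡 d).tangent
      (fun q => (⟨q, σ q⟩ : TangentBundle (𝓡 d) M)) x) (w : TangentSpace (𝓡 d) x) :
    chartCoframe p x (D σ x w) = mvfderiv (𝓡 d) (fun q => chartCoframe p q (σ q)) x w
      + christoffel hD p x (chartCoframe p x (σ x)) (chartCoframe p x w) := by
  rw [christoffel_apply, chartFrame_chartCoframe hx, chartFrame_chartCoframe hx]
  have h1 := IsCovariantDerivativeOn.difference_apply (hD.mono (subset_univ _))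
    (isCovariantDerivativeOn_chart p) hx hσ
  have h2 : chartDifference hD p x (σ x) w = D σ x w - flatConn (chartCoframe p) σ x w := by
    rw [chartDifference, h1]; rfl
  rw [h2, map_sub, flatConn, ContinuousLinearMap.comp_apply,
    (isInvertible_chartCoframe hx).self_apply_inverse, add_sub_cancel]

theorem chartCoframe_conn_chartFrame (hD : IsCovariantDerivativeOn (Euc d) D univ)
    (hx : x ∈ (chartTriv (d := d) p).baseSet) (v w : Euc d) :
    chartCoframe p x (D (fun q => chartFrame p q v) x (chartFrame p x w))
      = christoffel hD p x v w := by
  rw [chartCoframe_conn hD hx (mdifferentiableAt_chartFrame hx v), chartCoframe_chartFrame hx,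
    chartCoframe_chartFrame hx]
  have h1 : (fun q => chartCoframe p q (chartFrame p q v)) =ᶠ[𝓝 x] fun _ => v := by
    filter_upwards [(chartTriv p).open_baseSet.mem_nhds hx] with q hq
    exact chartCoframe_chartFrame hq v
  have h2 : mvfderiv (𝓡 d) (fun q => chartCoframe p q (chartFrame p q v)) x
      (chartFrame p x w) = 0 := by
    have h3 := (hasMFDerivAt_const (I := 𝓡 d) (I' := 𝓘(ℝ, Euc d)) v x).congr_of_eventuallyEq h1
    simp only [mvfderiv, h3.mfderiv]
    rfl
  rw [h2, zero_add]

/-- The derivative of the components of a parallel field in a chart. -/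
theorem IsParallelOn.hasDerivWithinAt_chart (hD : IsCovariantDerivativeOn (Euc d) D univ)
    {V : ℝ → TangentBundle (𝓡 d) M} {J : Set ℝ} (hV : IsParallelOn D V J) {t : ℝ} (ht : t ∈ J)
    (hp : (V t).proj ∈ (chartTriv (d := d) p).baseSet) (hJ : UniqueDiffWithinAt ℝ J t) {b : Euc d}
    (hb : HasDerivWithinAt (fun τ => extChartAt (𝓡 d) p (V τ).proj) b J t) :
    HasDerivWithinAt (fun τ => chartCoframe p (V τ).proj (V τ).snd)
      (-christoffel hD p (V t).proj (chartCoframe p (V t).proj (V t).snd) b) J t := by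
  have hγt : MDifferentiableWithinAt 𝓘(ℝ, ℝ) (𝓡 d) (fun τ => (V τ).proj) J t :=
    (hV.1 t ht).mdifferentiableWithinAt (by simp)
  refine (hV.hasDerivWithinAt ht (coframeDiffAt_chartCoframe hp)).congr_deriv ?_
  rw [chartCoframe_conn hD hp (by
    have h4 := FiberBundle.mdifferentiableAt_extend (𝓡 d) (Euc d) (V t).snd
    simpa only [FiberBundle.extend, trivializationAt_self_apply] using h4), sub_add_cancel_left]
  have h1 : chartCoframe p (V t).proj
      (mfderivWithin 𝓘(ℝ, ℝ) (𝓡 d) (fun τ => (V τ).proj) J t (1 : ℝ)) = b := by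
    rw [chartCoframe_eq_mfderiv hp]
    have h2 : HasMFDerivWithinAt 𝓘(ℝ, ℝ) 𝓘(ℝ, Euc d)
        (extChartAt (𝓡 d) p ∘ fun τ => (V τ).proj) J t
        (mfderiv (𝓡 d) 𝓘(ℝ, Euc d) (extChartAt (𝓡 d) p) (V t).proj ∘L
          mfderivWithin 𝓘(ℝ, ℝ) (𝓡 d) (fun τ => (V τ).proj) J t) :=
      HasMFDerivAt.comp_hasMFDerivWithinAt t (mdifferentiableAt_extChartAt
        (by rwa [TangentBundle.trivializationAt_baseSet] at hp)).hasMFDerivAt hγt.hasMFDerivWithinAt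
    have h3 : HasFDerivWithinAt (fun τ => extChartAt (𝓡 d) p (V τ).proj)
        (mfderiv (𝓡 d) 𝓘(ℝ, Euc d) (extChartAt (𝓡 d) p) (V t).proj ∘L
          mfderivWithin 𝓘(ℝ, ℝ) (𝓡 d) (fun τ => (V τ).proj) J t : ℝ →L[ℝ] Euc d) J t :=
      h2.hasFDerivWithinAt
    -- Uniqueness of derivatives on `J` identifies the prescribed coordinate velocity `b` with the
    -- image of the velocity of the curve on `M`.
    exact hJ.eq_deriv _ h3.hasDerivWithinAt hb
  rw [h1]
  have h5 : (chartTriv (d := d) (V t).proj).symm (V t).proj (V t).snd = (V t).snd := by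
    have := FiberBundle.extend_apply_self (F := Euc d) (V t).snd
    simpa only [FiberBundle.extend, trivializationAt_self_apply] using this
  exact congrArg (fun z => -christoffel hD p (V t).proj (chartCoframe p (V t).proj z) b) h5

end ChartCoframe

/-! ### Curvature in coordinates. -/

theorem differentiableAt_of_forall_apply {E F G : Type*} [NormedAddCommGroup E] [NormedSpace ℝ E]
    [NormedAddCommGroup F] [NormedSpace ℝ F] [NormedAddCommGroup G] [NormedSpace ℝ G]
    [FiniteDimensional ℝ F] {f : E → F →L[ℝ] G} {x : E}
    (h : ∀ v, DifferentiableAt ℝ (fun u => f u v) x) : DifferentiableAt ℝ f x := by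
  let b := Module.finBasis ℝ F
  have h1 : f = fun u => ∑ i, ContinuousLinearMap.smulRightL ℝ F G
      (LinearMap.toContinuousLinearMap (b.coord i)) (f u (b i)) := by
    funext u
    ext1 v
    simp only [sum_apply, ContinuousLinearMap.smulRightL_apply_apply]
    conv_lhs => rw [← b.sum_repr v, map_sum]
    simp only [map_smul]
    rfl
  rw [h1]
  exact DifferentiableAt.fun_sum fun i _ =>
    (ContinuousLinearMap.differentiableAt _).comp x (h (b i))

/-- The curvature of a connection in coordinates. -/
theorem curvatureForm_eq_of_contDiffAt {E : Type*} [NormedAddCommGroup E] [NormedSpace ℝ E]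
    {Γ : E → E →L[ℝ] E →L[ℝ] E} {ξ η ζ : E → E} {u : E} (hΓ : DifferentiableAt ℝ Γ u)
    (hξ : DifferentiableAt ℝ ξ u) (hη : DifferentiableAt ℝ η u) (hζ : ContDiffAt ℝ 2 ζ u) :
    (fderiv ℝ (fun z => fderiv ℝ ζ z (η z) + Γ z (ζ z) (η z)) u (ξ u)
        + Γ u (fderiv ℝ ζ u (η u) + Γ u (ζ u) (η u)) (ξ u))
      - (fderiv ℝ (fun z => fderiv ℝ ζ z (ξ z) + Γ z (ζ z) (ξ z)) u (η u)
        + Γ u (fderiv ℝ ζ u (ξ u) + Γ u (ζ u) (ξ u)) (η u))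
      - (fderiv ℝ ζ u (fderiv ℝ η u (ξ u) - fderiv ℝ ξ u (η u))
        + Γ u (ζ u) (fderiv ℝ η u (ξ u) - fderiv ℝ ξ u (η u)))
      = curvatureForm (Γ u) (fderiv ℝ Γ u) (ξ u) (η u) (ζ u) := by
  have hζ1 : DifferentiableAt ℝ ζ u := hζ.differentiableAt (by norm_num)
  have hζ2 : DifferentiableAt ℝ (fderiv ℝ ζ) u :=
    (hζ.fderiv_right (m := 1) (by norm_num)).differentiableAt (by norm_num)
  have h1 : ∀ {θ : E → E}, DifferentiableAt ℝ θ u → ∀ v,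
      fderiv ℝ (fun z => fderiv ℝ ζ z (θ z) + Γ z (ζ z) (θ z)) u v
        = fderiv ℝ (fderiv ℝ ζ) u v (θ u) + fderiv ℝ ζ u (fderiv ℝ θ u v)
          + (fderiv ℝ Γ u v (ζ u) (θ u) + Γ u (fderiv ℝ ζ u v) (θ u)
            + Γ u (ζ u) (fderiv ℝ θ u v)) := by
    intro θ hθ v
    have h2 := (hζ2.hasFDerivAt.clm_apply hθ.hasFDerivAt).fun_add
      ((hΓ.hasFDerivAt.clm_apply hζ1.hasFDerivAt).clm_apply hθ.hasFDerivAt)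
    rw [HasFDerivAt.fderiv h2]
    simp only [add_apply, ContinuousLinearMap.comp_apply, ContinuousLinearMap.flip_apply]
    abel
  -- The second derivatives of `ζ` cancel by symmetry, which is where `C^2` regularity of `ζ` is
  -- needed.
  have h3 : fderiv ℝ (fderiv ℝ ζ) u (ξ u) (η u) = fderiv ℝ (fderiv ℝ ζ) u (η u) (ξ u) :=
    hζ.isSymmSndFDerivAt (by simp) (ξ u) (η u)
  rw [h1 hη, h1 hξ, h3, curvatureForm_apply]
  simp only [map_add, map_sub, add_apply]
  abel

section Curvature

variable {d : ℕ} {M : Type u} [TopologicalSpace M] [ChartedSpace (Euc d) M]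
  [IsManifold (𝓡 d) ∞ M] {p : M}

theorem chartTriv_baseSet_mem_nhds (p : M) : (chartTriv (d := d) p).baseSet ∈ 𝓝 p :=
  (chartTriv p).open_baseSet.mem_nhds (FiberBundle.mem_baseSet_trivializationAt' p)

omit [IsManifold (𝓡 d) ∞ M] in
theorem differentiableAt_comp_extChartAt_symm {F : Type*} [NormedAddCommGroup F] [NormedSpace ℝ F]
    {f : M → F} (hf : MDifferentiableAt (𝓡 d) 𝓘(ℝ, F) f p) :
    DifferentiableAt ℝ (fun u => f ((extChartAt (𝓡 d) p).symm u)) (extChartAt (𝓡 d) p p) := by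
  have h := (mdifferentiableWithinAt_univ.2
    hf).differentiableWithinAt_comp_extChartAt_symm
  rwa [preimage_univ, univ_inter, ModelWithCorners.range_eq_univ,
    differentiableWithinAt_univ] at h

/-- The Christoffel symbols of a smooth connection are differentiable. -/
theorem differentiableAt_christoffel [T2Space M]
    (D : CovariantDerivative (𝓡 d) (Euc d) (TangentSpace (𝓡 d) : M → Type))
    (hD : CovariantDerivative.ContMDiffCovariantDerivative D ∞) (p : M) :
    DifferentiableAt ℝ (fun u => christoffel (d := d) D.isCovariantDerivativeOnUniv p
      ((extChartAt (𝓡 d) p).symm u)) (extChartAt (𝓡 d) p p) := by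
  refine differentiableAt_of_forall_apply fun v => ?_
  refine differentiableAt_comp_extChartAt_symm
    (f := fun x => christoffel D.isCovariantDerivativeOnUniv p x v) ?_
  obtain ⟨f⟩ : Nonempty (SmoothBumpFunction (𝓡 d) p) := inferInstance
  -- Smoothness of `D` is tested on global fields, so the coordinate field is cut off by a bump
  -- function; near `p` the cutoff equals one and, by locality, does not affect `D`.
  let σ : (x : M) → TangentSpace (𝓡 d) x := (f : M → ℝ) • fun x => chartFrame p x v
  have hσ : ContMDiff (𝓡 d) (𝓡 d).tangent ∞ (fun x => (⟨x, σ x⟩ : TangentBundle (𝓡 d) M)) :=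
    ContMDiffOn.smul_section_of_tsupport f.contMDiff.contMDiffOn (chartTriv p).open_baseSet
      (by rw [TangentBundle.trivializationAt_baseSet]; exact f.tsupport_subset_chartAt_source)
      (contMDiffOn_chartFrame p v)
  have h1 := hD.contMDiff.contMDiff (σ := σ) hσ.contMDiffOn
  have h2 := ((mdifferentiableAt_hom_bundle _).1
    ((contMDiffOn_univ.1 h1).contMDiffAt (x := p) |>.mdifferentiableAt (by simp))).2
  refine h2.congr_of_eventuallyEq ?_
  have h3 : ∀ᶠ x in 𝓝 p, σ x = chartFrame p x v := by
    filter_upwards [f.eventuallyEq_one] with x hx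
    show f x • chartFrame p x v = chartFrame p x v
    rw [hx, Pi.one_apply, one_smul]
  filter_upwards [eventually_eventually_nhds.2 h3, chartTriv_baseSet_mem_nhds (d := d) p]
    with x hx hxp
  have h4 : D σ x = D (fun q => chartFrame p q v) x :=
    D.isCovariantDerivativeOnUniv.congr_of_eventuallyEq
      ((hσ x).mdifferentiableAt (by simp)) (mdifferentiableAt_chartFrame hxp v) univ_mem hx
  ext1 w
  show _ = chartCoframe p x (D σ x (chartFrame p x w))
  rw [h4]
  exact (chartCoframe_conn_chartFrame D.isCovariantDerivativeOnUniv hxp v w).symm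

/-- The coordinates of the Lie bracket at the base point of the chart. -/
theorem mlieBracket_eq_fderiv {X Y : (x : M) → TangentSpace (𝓡 d) x} :
    (VectorField.mlieBracket (𝓡 d) X Y p : Euc d) =
      fderiv ℝ (fun u => chartCoframe p ((extChartAt (𝓡 d) p).symm u)
        (Y ((extChartAt (𝓡 d) p).symm u))) (extChartAt (𝓡 d) p p) (X p)
      - fderiv ℝ (fun u => chartCoframe p ((extChartAt (𝓡 d) p).symm u)
        (X ((extChartAt (𝓡 d) p).symm u))) (extChartAt (𝓡 d) p p) (Y p) := by
  have h1 : ∀ Z : (x : M) → TangentSpace (𝓡 d) x,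
      VectorField.mpullbackWithin 𝓘(ℝ, Euc d) (𝓡 d) (extChartAt (𝓡 d) p).symm Z (range (𝓡 d))
        =ᶠ[𝓝 (extChartAt (𝓡 d) p p)] fun u => chartCoframe p ((extChartAt (𝓡 d) p).symm u)
        (Z ((extChartAt (𝓡 d) p).symm u)) := by
    intro Z
    filter_upwards [extChartAt_target_mem_nhds (I := 𝓡 d) p] with u hu
    have hx : (extChartAt (𝓡 d) p).symm u ∈ (chartTriv (d := d) p).baseSet := by
      rw [TangentBundle.trivializationAt_baseSet, ← extChartAt_source (𝓡 d)]
      exact (extChartAt (𝓡 d) p).map_target hu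
    rw [VectorField.mpullbackWithin_apply, chartCoframe_eq_mfderiv hx,
      ContinuousLinearMap.inverse_eq (mfderivWithin_extChartAt_symm_comp_mfderiv_extChartAt hu)
        (mfderiv_extChartAt_comp_mfderivWithin_extChartAt_symm hu)]
    rfl
  -- The tangent space at `p` is modelled on the chart at `p`, so the derivative of that chart at
  -- its own center is the identity.
  have h2 : ∀ z, (mfderiv (𝓡 d) 𝓘(ℝ, Euc d) (extChartAt (𝓡 d) p) p).inverse z = z := by
    intro z
    refine (congrArg (fun L : Euc d →L[ℝ] Euc d => L.inverse z)
      (mfderiv_extChartAt_self (I := 𝓡 d) (x := p))).trans ?_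
    exact congrArg (fun L : Euc d →L[ℝ] Euc d => L z) ContinuousLinearMap.inverse_id
  have h3 : (extChartAt (𝓡 d) p).symm ⁻¹' univ ∩ range (𝓡 d) = univ := by
    rw [preimage_univ, univ_inter, ModelWithCorners.range_eq_univ]
  have h4 := VectorField.mlieBracketWithin_apply (I := 𝓡 d) (V := X) (W := Y) (s := univ)
    (x₀ := p)
  rw [VectorField.mlieBracketWithin_univ, h3] at h4
  have h5 : ∀ A B : Euc d → Euc d, VectorField.lieBracketWithin ℝ A B univ (extChartAt (𝓡 d) p p)
      = VectorField.lieBracket ℝ A B (extChartAt (𝓡 d) p p) := fun A B => by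
    rw [VectorField.lieBracketWithin_univ]
  refine h4.trans ((h2 _).trans ((h5 _ _).trans
    (((h1 X).lieBracket_vectorField_eq (h1 Y)).trans ?_)))
  have h6 : ∀ Z : (x : M) → TangentSpace (𝓡 d) x,
      (chartCoframe p ((extChartAt (𝓡 d) p).symm (extChartAt (𝓡 d) p p))
        (Z ((extChartAt (𝓡 d) p).symm (extChartAt (𝓡 d) p p))) : Euc d) = Z p := fun Z => by
    rw [extChartAt_to_inv, chartCoframe_self]
  exact congrArg₂ (· - ·) (congrArg (fderiv ℝ _ _) (h6 X)) (congrArg (fderiv ℝ _ _) (h6 Y))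

theorem mvfderiv_eq_fderiv {F : Type*} [NormedAddCommGroup F] [NormedSpace ℝ F] {f : M → F} {x : M}
    (hx : x ∈ (chartTriv (d := d) p).baseSet) (hf : DifferentiableAt ℝ
      (fun u => f ((extChartAt (𝓡 d) p).symm u)) (extChartAt (𝓡 d) p x))
    (w : TangentSpace (𝓡 d) x) :
    mvfderiv (𝓡 d) f x w = fderiv ℝ (fun u => f ((extChartAt (𝓡 d) p).symm u))
      (extChartAt (𝓡 d) p x) (chartCoframe p x w) := by
  have hx' : x ∈ (chartAt (Euc d) p).source := by
    rwa [TangentBundle.trivializationAt_baseSet] at hx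
  have h1 : f =ᶠ[𝓝 x] (fun u => f ((extChartAt (𝓡 d) p).symm u)) ∘ extChartAt (𝓡 d) p := by
    filter_upwards [extChartAt_source_mem_nhds' (I := 𝓡 d) (by rwa [extChartAt_source])] with q hq
    exact (congrArg f ((extChartAt (𝓡 d) p).left_inv hq)).symm
  have h2 := (HasMFDerivAt.comp x hf.hasFDerivAt.hasMFDerivAt
    (mdifferentiableAt_extChartAt (I := 𝓡 d) hx').hasMFDerivAt).congr_of_eventuallyEq h1
  simp only [mvfderiv, h2.mfderiv]
  rw [chartCoframe_eq_mfderiv hx]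
  rfl

theorem contDiffAt_coordinates {Z : (x : M) → TangentSpace (𝓡 d) x}
    (hZ : ContMDiff (𝓡 d) (𝓡 d).tangent ∞ (fun q => (⟨q, Z q⟩ : TangentBundle (𝓡 d) M))) (p : M) :
    ContDiffAt ℝ ∞ (fun u => chartCoframe p ((extChartAt (𝓡 d) p).symm u)
      (Z ((extChartAt (𝓡 d) p).symm u))) (extChartAt (𝓡 d) p p) := by
  have h1 : ContMDiffAt (𝓡 d) 𝓘(ℝ, Euc d) ∞ (fun x => chartCoframe p x (Z x)) p := by
    refine ((contMDiffAt_section p).1 (hZ p)).congr_of_eventuallyEq ?_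
    filter_upwards [chartTriv_baseSet_mem_nhds (d := d) p] with x hx
    rw [chartCoframe, Trivialization.continuousLinearMapAt_apply,
      Trivialization.coe_linearMapAt_of_mem _ hx]
  have h2 : ContMDiffAt 𝓘(ℝ, Euc d) (𝓡 d) ∞ (extChartAt (𝓡 d) p).symm (extChartAt (𝓡 d) p p) :=
    (contMDiffOn_extChartAt_symm p).contMDiffAt (extChartAt_target_mem_nhds p)
  exact (ContMDiffAt.comp (extChartAt (𝓡 d) p p) (by rwa [extChartAt_to_inv]) h2).contDiffAt

/-- This identifies the invariant curvature with the second order coefficient of the holonomy. Only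
the value at the center of the chart is needed, where coordinate vectors and tangent vectors
coincide. -/
theorem curvature_eq_curvatureForm [T2Space M]
    (D : CovariantDerivative (𝓡 d) (Euc d) (TangentSpace (𝓡 d) : M → Type))
    (hD : CovariantDerivative.ContMDiffCovariantDerivative D ∞)
    {X Y Z : (x : M) → TangentSpace (𝓡 d) x}
    (hX : ContMDiff (𝓡 d) (𝓡 d).tangent ∞ (fun q => (⟨q, X q⟩ : TangentBundle (𝓡 d) M)))
    (hY : ContMDiff (𝓡 d) (𝓡 d).tangent ∞ (fun q => (⟨q, Y q⟩ : TangentBundle (𝓡 d) M)))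
    (hZ : ContMDiff (𝓡 d) (𝓡 d).tangent ∞ (fun q => (⟨q, Z q⟩ : TangentBundle (𝓡 d) M))) (p : M) :
    (curvature (d := d) D X Y Z p : Euc d) =
      curvatureForm (christoffel (d := d) D.isCovariantDerivativeOnUniv p p)
        (fderiv ℝ (fun u => christoffel (d := d) D.isCovariantDerivativeOnUniv p
          ((extChartAt (𝓡 d) p).symm u)) (extChartAt (𝓡 d) p p)) (X p) (Y p) (Z p) := by
  set φ := extChartAt (𝓡 d) p with hφ
  have hD' := D.isCovariantDerivativeOnUniv
  have hp : p ∈ (chartTriv (d := d) p).baseSet := FiberBundle.mem_baseSet_trivializationAt' p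
  let coord : ((x : M) → TangentSpace (𝓡 d) x) → Euc d → Euc d :=
    fun Z u => chartCoframe p (φ.symm u) (Z (φ.symm u))
  have hcoord : ∀ Z : (x : M) → TangentSpace (𝓡 d) x, coord Z (φ p) = Z p := fun Z => by
    show chartCoframe p (φ.symm (φ p)) (Z (φ.symm (φ p))) = Z p
    rw [extChartAt_to_inv, chartCoframe_self]
  let Γ : Euc d → Euc d →L[ℝ] Euc d →L[ℝ] Euc d := fun u => christoffel (d := d) hD' p (φ.symm u)
  have hΓp : Γ (φ p) = christoffel (d := d) hD' p p := by
    show christoffel (d := d) hD' p (φ.symm (φ p)) = _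
    rw [extChartAt_to_inv]
  have hζ := contDiffAt_coordinates hZ p
  -- The inner covariant derivative is differentiated once more, so its coordinate formula is
  -- required on a neighborhood of `φ p`.
  have h1 : ∀ W : (x : M) → TangentSpace (𝓡 d) x,
      ContMDiff (𝓡 d) (𝓡 d).tangent ∞ (fun q => (⟨q, W q⟩ : TangentBundle (𝓡 d) M)) →
      coord (fun q => D Z q (W q)) =ᶠ[𝓝 (φ p)]
        fun u => fderiv ℝ (coord Z) u (coord W u) + Γ u (coord Z u) (coord W u) := by
    intro W hW
    have h2 : ∀ᶠ u in 𝓝 (φ p), DifferentiableAt ℝ (coord Z) u := by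
      filter_upwards [(hζ.of_le (m := 1) (by simp)).eventually (by simp)] with u hu
      exact hu.differentiableAt (by simp)
    filter_upwards [extChartAt_target_mem_nhds (I := 𝓡 d) p, h2] with u hu hd
    have hx : φ.symm u ∈ (chartTriv (d := d) p).baseSet := by
      rw [TangentBundle.trivializationAt_baseSet, ← extChartAt_source (𝓡 d)]
      exact φ.map_target hu
    have h3 : φ (φ.symm u) = u := φ.right_inv hu
    refine (chartCoframe_conn hD' hx ((hZ _).mdifferentiableAt (by simp)) _).trans ?_
    rw [mvfderiv_eq_fderiv hx (by rw [← hφ, h3]; exact hd), ← hφ, h3]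
  have h4 : ∀ V W : (x : M) → TangentSpace (𝓡 d) x,
      ContMDiff (𝓡 d) (𝓡 d).tangent ∞ (fun q => (⟨q, W q⟩ : TangentBundle (𝓡 d) M)) →
      (D (fun q => D Z q (W q)) p (V p) : Euc d) =
        fderiv ℝ (fun u => fderiv ℝ (coord Z) u (coord W u) + Γ u (coord Z u) (coord W u)) (φ p)
          (coord V (φ p))
        + Γ (φ p) (fderiv ℝ (coord Z) (φ p) (coord W (φ p))
          + Γ (φ p) (coord Z (φ p)) (coord W (φ p))) (coord V (φ p)) := by
    intro V W hW
    have h5 : ContMDiff (𝓡 d) (𝓡 d).tangent ∞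
        (fun q => (⟨q, D Z q (W q)⟩ : TangentBundle (𝓡 d) M)) := by
      have h6 := contMDiffOn_univ.1 (hD.contMDiff.contMDiff (σ := Z) hZ.contMDiffOn)
      exact ContMDiff.clm_bundle_apply h6 hW
    have h8 := chartCoframe_conn hD' hp ((h5 p).mdifferentiableAt (by simp)) (V p)
    rw [chartCoframe_self, mvfderiv_eq_fderiv hp
      ((contDiffAt_coordinates h5 p).differentiableAt (by simp)), ← hφ,
      chartCoframe_self, chartCoframe_self] at h8
    rw [← (h1 W hW).eq_of_nhds, ← (h1 W hW).fderiv_eq, hΓp]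
    exact h8.trans (congrArg₂ (fun a b : Euc d => fderiv ℝ (coord fun q => D Z q (W q)) (φ p) a
      + christoffel (d := d) hD' p p b a) (hcoord V).symm (hcoord fun q => D Z q (W q)).symm)
  have h10 : (D Z p (VectorField.mlieBracket (𝓡 d) X Y p) : Euc d)
      = fderiv ℝ (coord Z) (φ p)
          (fderiv ℝ (coord Y) (φ p) (coord X (φ p)) - fderiv ℝ (coord X) (φ p) (coord Y (φ p)))
        + Γ (φ p) (coord Z (φ p))
          (fderiv ℝ (coord Y) (φ p) (coord X (φ p)) - fderiv ℝ (coord X) (φ p) (coord Y (φ p))) := by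
    have h8 := chartCoframe_conn hD' hp ((hZ p).mdifferentiableAt (by simp))
      (VectorField.mlieBracket (𝓡 d) X Y p)
    rw [chartCoframe_self, mvfderiv_eq_fderiv hp (hζ.differentiableAt (by simp)), ← hφ,
      chartCoframe_self, chartCoframe_self] at h8
    rw [hΓp, hcoord, hcoord, hcoord]
    exact h8.trans (congrArg (fun b : Euc d => fderiv ℝ (coord Z) (φ p) b
      + christoffel (d := d) hD' p p (Z p) b) mlieBracket_eq_fderiv)
  have h11 := curvatureForm_eq_of_contDiffAt (Γ := Γ) (ξ := coord X) (η := coord Y)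
    (ζ := coord Z) (differentiableAt_christoffel D hD p)
    ((contDiffAt_coordinates hX p).differentiableAt (by simp))
    ((contDiffAt_coordinates hY p).differentiableAt (by simp))
    (hζ.of_le (m := 2) ENat.LEInfty.out)
  refine (congrArg₂ (· - ·) (congrArg₂ (· - ·) (h4 X Y hY) (h4 Y X hX)) h10).trans
    (h11.trans ?_)
  rw [hΓp, hcoord, hcoord, hcoord]

end Curvature

/-! ### Holonomy along small loops in a manifold, and its limits. -/

/-- A parallel field projects to the given curve only on `[0, 1]`; the pieces must lie there for the
coordinate velocity to be computed from the curve. -/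
theorem Piecewise.subset_unitInterval {Q : Set ℝ → Prop} (h : Piecewise Q) :
    Piecewise fun J => J ⊆ Icc 0 1 ∧ Q J := by
  obtain ⟨k, t, h0, h1, ht⟩ := h
  have hmono : ∀ i j, i ≤ j → j ≤ k → t i ≤ t j := by
    intro i j hij
    induction j, hij using Nat.le_induction with
    | base => exact fun _ => le_rfl
    | succ j _ ih => exact fun hj => (ih (by omega)).trans (ht j (by omega)).1.le
  refine ⟨k, t, h0, h1, fun i hi => ⟨(ht i hi).1, ?_, (ht i hi).2⟩⟩
  exact Icc_subset_Icc (h0 ▸ hmono 0 i (by omega) (by omega)) (h1 ▸ hmono (i + 1) k (by omega) le_rfl)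

/-- Convergence in a fiber bundle. -/
theorem tendsto_trivializationAt {B F : Type*} [TopologicalSpace B] [TopologicalSpace F]
    {E : B → Type*} [TopologicalSpace (TotalSpace F E)] [∀ x, TopologicalSpace (E x)]
    [FiberBundle F E] {ι : Type*} {l : Filter ι} {f : ι → TotalSpace F E} {z : TotalSpace F E}
    (hf : Tendsto f l (𝓝 z)) : Tendsto (fun i => (f i).proj) l (𝓝 z.proj) ∧
      Tendsto (fun i => (trivializationAt F E z.proj (f i)).2) l
        (𝓝 (trivializationAt F E z.proj z).2) :=
  ⟨((FiberBundle.continuous_proj F E).tendsto _).comp hf, ((continuous_snd.tendsto _).comp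
    ((trivializationAt F E z.proj).continuousAt
      FiberBundle.mem_trivializationAt_proj_source).tendsto).comp hf⟩

section Holonomy

variable {d : ℕ} {M : Type u} [TopologicalSpace M] [ChartedSpace (Euc d) M]
  [IsManifold (𝓡 d) ∞ M] {p : M}

/-- The loop at `p` given in the chart at `p` by `s • loop x y`. -/
noncomputable def chartLoop (p : M) (x y : Euc d) (s t : ℝ) : M :=
  (extChartAt (𝓡 d) p).symm (extChartAt (𝓡 d) p p + s • loop x y t)

omit [IsManifold (𝓡 d) ∞ M] in
theorem eventually_chartLoop_mem_target (p : M) (x y : Euc d) :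
    ∀ᶠ s : ℝ in 𝓝[>] 0, ∀ t ∈ Icc (0 : ℝ) 1,
      extChartAt (𝓡 d) p p + s • loop x y t ∈ (extChartAt (𝓡 d) p).target := by
  obtain ⟨r, hr, hball⟩ := Metric.mem_nhds_iff.1 (extChartAt_target_mem_nhds (I := 𝓡 d) p)
  have h1 : Tendsto (fun s : ℝ => |s| * (‖x‖ + ‖y‖)) (𝓝[>] 0) (𝓝 0) := by
    have : Continuous fun s : ℝ => |s| * (‖x‖ + ‖y‖) := by fun_prop
    simpa using (this.tendsto 0).mono_left nhdsWithin_le_nhds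
  filter_upwards [h1.eventually_lt_const hr] with s hs t ht
  refine hball ?_
  rw [mem_ball_iff_norm, add_sub_cancel_left, norm_smul, Real.norm_eq_abs]
  exact (mul_le_mul_of_nonneg_left (norm_loop_le x y ht) (abs_nonneg s)).trans_lt hs

theorem isClosedCurve_chartLoop {x y : Euc d} {s : ℝ} (hs : ∀ t ∈ Icc (0 : ℝ) 1,
      extChartAt (𝓡 d) p p + s • loop x y t ∈ (extChartAt (𝓡 d) p).target) :
    IsClosedCurve d (chartLoop p x y s) p := by
  refine ⟨by simp [chartLoop], by simp [chartLoop], 1, fun i => i, by simp, by simp, ?_⟩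
  intro i hi
  obtain rfl : i = 0 := by omega
  refine ⟨by simp, ?_⟩
  have h1 : ContMDiff 𝓘(ℝ, ℝ) 𝓘(ℝ, Euc d) ∞
      fun t => extChartAt (𝓡 d) p p + s • loop x y t :=
    (contDiff_const.add ((contDiff_loop x y).const_smul s)).contMDiff
  exact (contMDiffOn_extChartAt_symm p).comp h1.contMDiffOn fun t ht => hs t (by simpa using ht)

/-- The components of a parallel field in the chart at `p` solve the linear equation of
`eventually_norm_holonomy_sub_le`. The chart coframe is the identity at `p`, so `h` appears without
change of coordinates. The admissible `s` do not depend on `h` or on the initial vector. -/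
theorem eventually_norm_parallelTransport_sub_le [T2Space M]
    (D : CovariantDerivative (𝓡 d) (Euc d) (TangentSpace (𝓡 d) : M → Type))
    (hD : CovariantDerivative.ContMDiffCovariantDerivative D ∞) (p : M) (x y : Euc d) {ε : ℝ}
    (hε : 0 < ε) :
    ∀ᶠ s : ℝ in 𝓝[>] 0, ∀ h : Euc d →L[ℝ] Euc d,
      IsParallelTransport (d := d) (M := M) (p := p) (q := p) D (chartLoop p x y s) h →
      ‖h - 1 + s ^ 2 • (1 / 60 : ℝ) •
        curvatureForm (christoffel (d := d) D.isCovariantDerivativeOnUniv p p)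
        (fderiv ℝ (fun u => christoffel (d := d) D.isCovariantDerivativeOnUniv p
          ((extChartAt (𝓡 d) p).symm u)) (extChartAt (𝓡 d) p p)) x y‖ ≤ ε * s ^ 2 := by
  have h1 := eventually_norm_holonomy_sub_le
    (differentiableAt_christoffel D hD p).hasFDerivAt x y hε
  rw [extChartAt_to_inv] at h1
  filter_upwards [h1, eventually_chartLoop_mem_target p x y] with s hs hs' h hh
  refine ContinuousLinearMap.opNorm_le_bound _ (by positivity) fun v => ?_
  obtain ⟨V, hV, hV0, hV1, hpar⟩ := hh v
  have hext : ∀ t ∈ Icc (0 : ℝ) 1,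
      extChartAt (𝓡 d) p (V t).proj = extChartAt (𝓡 d) p p + s • loop x y t := fun t ht => by
    rw [hV t ht]
    exact (extChartAt (𝓡 d) p).right_inv (hs' t ht)
  have h2 := hpar.subset_unitInterval.hasDerivWithinAt (a := 0) (b := 1)
    (f := fun τ => chartCoframe p (V τ).proj (V τ).snd)
    (f' := fun t => -christoffel (d := d) D.isCovariantDerivativeOnUniv p
      ((extChartAt (𝓡 d) p).symm (extChartAt (𝓡 d) p p + s • loop x y t))
      (chartCoframe p (V t).proj (V t).snd) (s • loopDeriv x y t)) le_rfl le_rfl (by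
        rintro a b hab ⟨hsub, hQ⟩ t ht ht'
        have hb : (V t).proj ∈ (chartTriv (d := d) p).baseSet := by
          rw [hV t ht', TangentBundle.trivializationAt_baseSet, ← extChartAt_source (𝓡 d)]
          exact (extChartAt (𝓡 d) p).map_target (hs' t ht')
        have h3 : HasDerivWithinAt (fun τ => extChartAt (𝓡 d) p (V τ).proj)
            (s • loopDeriv x y t) (Icc a b) t :=
          (((hasDerivAt_loop x y t).const_smul s).const_add
            (extChartAt (𝓡 d) p p)).hasDerivWithinAt.congr_of_mem
            (fun τ hτ => hext τ (hsub hτ)) ht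
        have h4 := hQ.hasDerivWithinAt_chart D.isCovariantDerivativeOnUniv ht hb
          (uniqueDiffOn_Icc hab t ht) h3
        have h5 : (extChartAt (𝓡 d) p).symm (extChartAt (𝓡 d) p p + s • loop x y t)
            = (V t).proj := (hV t ht').symm
        rw [h5]
        exact h4)
  have h6 := hs _ h2.1 h2.2
  have h0 : chartCoframe p (V 0).proj (V 0).snd = v := by rw [hV0, chartCoframe_self]
  have h1 : chartCoframe p (V 1).proj (V 1).snd = h v := by
    rw [hV1]
    exact chartCoframe_self p _
  simp only [h0, h1] at h6
  exact h6

/-- Powers of an endomorphism in a trivialization. -/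
theorem inCoordinates_pow {q : M} (hq : q ∈ (chartTriv (d := d) p).baseSet)
    (h : TangentSpace (𝓡 d) q →L[ℝ] TangentSpace (𝓡 d) q) (N : ℕ) :
    (chartCoframe p q ∘L h ∘L chartFrame p q : Euc d →L[ℝ] Euc d) ^ N
      = chartCoframe p q ∘L (h ^ N) ∘L chartFrame p q := by
  induction N with
  | zero =>
    ext1 v
    exact (chartCoframe_chartFrame hq v).symm
  | succ N ih =>
    rw [pow_succ, ih]
    ext1 v
    simp only [mul_apply_eq_comp, ContinuousLinearMap.comp_apply, pow_succ,
      chartFrame_chartCoframe hq]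

/-- The relation `h ^ N = 1` is closed in the endomorphism bundle. -/
theorem pow_eq_one_of_tendsto {N : ℕ} {p' : ℕ → M}
    {h' : (n : ℕ) → TangentSpace (𝓡 d) (p' n) →L[ℝ] TangentSpace (𝓡 d) (p' n)}
    {h : TangentSpace (𝓡 d) p →L[ℝ] TangentSpace (𝓡 d) p}
    (hlim : Tendsto (fun n => (TotalSpace.mk' (Euc d →L[ℝ] Euc d) (p' n) (h' n) :
          TotalSpace (Euc d →L[ℝ] Euc d)
            (fun x : M => TangentSpace (𝓡 d) x →L[ℝ] TangentSpace (𝓡 d) x))) atTop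
        (𝓝 (TotalSpace.mk' (Euc d →L[ℝ] Euc d) p h)))
    (hN : ∀ᶠ n in atTop, h' n ^ N = 1) : (h : Euc d →L[ℝ] Euc d) ^ N = 1 := by
  have hp : p ∈ (chartTriv (d := d) p).baseSet := FiberBundle.mem_baseSet_trivializationAt' p
  obtain ⟨h1, h4⟩ := tendsto_trivializationAt hlim
  have h2 : Tendsto (fun n => (chartCoframe p (p' n) ∘L h' n ∘L chartFrame p (p' n) :
      Euc d →L[ℝ] Euc d)) atTop (𝓝 (chartCoframe p p ∘L h ∘L chartFrame p p)) := h4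
  have h3 : (chartCoframe p p ∘L h ∘L chartFrame p p : Euc d →L[ℝ] Euc d) = h := by
    ext1 v
    exact (chartCoframe_self p _).trans (congrArg h (symmL_trivializationAt_self p v))
  rw [h3] at h2
  -- In the chart at `p` the maps `h' n` become conjugates by invertible frames, for which the
  -- `N`-th power is still one; no control of the frames is needed.
  refine tendsto_nhds_unique (X := Euc d →L[ℝ] Euc d) (h2.pow N) (tendsto_const_nhds.congr' ?_)
  filter_upwards [hN, h1.eventually (chartTriv_baseSet_mem_nhds (d := d) p)] with n hn hq
  rw [inCoordinates_pow hq, hn]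
  ext1 v
  exact (chartCoframe_chartFrame hq v).symm

theorem pow_parallelTransport_eq_one {𝒲 : Archetype d} (h𝒲 : IsUndistorted 𝒲) {N : ℕ}
    (hN : ∀ g ∈ symmetryGroup 𝒲, (g : Euc d →L[ℝ] Euc d) ^ N = 1) (B : DefectBody.{u, w} M 𝒲)
    {D : Conn d M} (hD : B.IsLeviCivita D) {γ : ℝ → M} {p : M} (hγ : IsClosedCurve d γ p)
    (hγB : MapsTo γ (Icc 0 1) B.carrier) {h : TangentSpace (𝓡 d) p →L[ℝ] TangentSpace (𝓡 d) p}
    (hh : IsParallelTransport D γ h) : h ^ N = 1 := by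
  have hp := hγB (show (0 : ℝ) ∈ Icc 0 1 by simp)
  rw [hγ.1, ← B.iUnion_U, mem_iUnion] at hp
  obtain ⟨α, hα⟩ := hp
  obtain ⟨g, hg, hgP⟩ := B.exists_symmetry h𝒲 hD hγ hγB hh hα
  have h1 : ∀ n : ℕ, ∀ v, B.P α p ((h ^ n) v) = ((g : Euc d →L[ℝ] Euc d) ^ n) (B.P α p v) := by
    intro n
    induction n with
    | zero => exact fun v => rfl
    | succ n ih =>
      intro v
      rw [pow_succ', pow_succ']
      exact (hgP _).trans (congrArg _ (ih v))
  obtain ⟨e, he⟩ := B.P_invertible α p hα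
  ext1 v
  have h2 := h1 N v
  rw [hN g hg, ← he] at h2
  exact e.injective h2

end Holonomy


/-- The connection of a limit of bodies with discrete defects is flat. -/
theorem isFlat_of_parallelTransportConverges {d : ℕ} {M : Type u} [TopologicalSpace M] [T2Space M]
    [ChartedSpace (Euc d) M] [IsManifold (𝓡 d) ∞ M] {𝒲 : Archetype d} (h𝒲 : IsUndistorted 𝒲)
    (hdisc : DiscreteTopology (symmetryGroup 𝒲)) {B : ℕ → DefectBody.{u, w} M 𝒲}
    {D : ℕ → Conn d M} (hB : ∀ n, (B n).IsLeviCivita (D n))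
    {D' : CovariantDerivative (𝓡 d) (Euc d) (TangentSpace (𝓡 d) : M → Type)}
    (hD' : CovariantDerivative.ContMDiffCovariantDerivative D' ∞)
    (hconv : ParallelTransportConverges (d := d) (fun n => (B n).carrier) D D') :
    IsFlat (d := d) (M := M) D' := by
  obtain ⟨N, hN0, hN⟩ := exists_pow_eq_one (fun g hg => (h𝒲 g hg).1) hdisc
  intro X Y Z hX hY hZ p
  have key : (1 / 60 : ℝ) • curvatureForm
      (christoffel (d := d) D'.isCovariantDerivativeOnUniv p p)
      (fderiv ℝ (fun u => christoffel (d := d) D'.isCovariantDerivativeOnUniv p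
        ((extChartAt (𝓡 d) p).symm u)) (extChartAt (𝓡 d) p p)) (X p) (Y p) = 0 := by
    refine eq_zero_of_pow_eq_one hN0 fun ε hε => ?_
    have h1 : Tendsto (fun s : ℝ => s ^ 2) (𝓝[>] 0) (𝓝 0) := by
      simpa using ((continuous_pow 2).tendsto (0 : ℝ)).mono_left nhdsWithin_le_nhds
    obtain ⟨s, hs0, hsε, hs, hloop⟩ := ((eventually_mem_nhdsWithin (a := (0 : ℝ))).and
      ((h1.eventually_lt_const hε).and
        ((eventually_norm_parallelTransport_sub_le D' hD' p (X p) (Y p) hε).and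
          (eventually_chartLoop_mem_target p (X p) (Y p))))).exists
    -- The size `s` is fixed before the limit over the bodies is taken; the limit `s → 0` comes
    -- last, inside `eq_zero_of_pow_eq_one` with `r = s ^ 2`.
    obtain ⟨h, γ', p', h', hh, hev, -, hlim⟩ := hconv _ p (isClosedCurve_chartLoop hloop)
    have hs0' : (0 : ℝ) < s := hs0
    refine ⟨s ^ 2, by positivity, hsε, h, pow_eq_one_of_tendsto hlim ?_, hs h hh⟩
    filter_upwards [hev] with n hn
    exact pow_parallelTransport_eq_one h𝒲 hN (B n) (hB n) hn.1 hn.2.1 hn.2.2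
  refine (curvature_eq_curvatureForm D' hD' hX hY hZ p).trans ?_
  rw [(smul_eq_zero.1 key).resolve_left (by norm_num)]
  rfl

end DiscreteDefects

open DiscreteDefects in
theorem mainTheorem3 {d : ℕ} (𝒲 : Archetype d) (h𝒲 : IsUndistorted 𝒲)
    (hdisc : DiscreteTopology (symmetryGroup 𝒲)) :
    (∃ ε : ℝ, 0 < ε ∧
      ∀ (M : Type u) [TopologicalSpace M] [T2Space M] [SecondCountableTopology M]
        [ChartedSpace (Euc d) M] [IsManifold (𝓡 d) ∞ M]
        (B : DefectBody.{u, w} M 𝒲) (γ : ℝ → M) (p : M)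
        (c : TangentSpace (𝓡 d) p →L[ℝ] TangentSpace (𝓡 d) p),
        B.IsDisclinationContent γ c →
          c = ContinuousLinearMap.id ℝ (TangentSpace (𝓡 d) p) ∨
          ∀ α : B.ι, p ∈ B.U α →
            ε ≤ ‖(B.P α p ∘L c ∘L (B.P α p).inverse) - ContinuousLinearMap.id ℝ (Euc d)‖) ∧
    (∀ (M : Type u) [TopologicalSpace M] [T2Space M] [SecondCountableTopology M]
        [ChartedSpace (Euc d) M] [IsManifold (𝓡 d) ∞ M]
        (Conv : (ℕ → DefectBody.{u, w} M 𝒲) → (ℕ → Conn d M) →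
          CovariantDerivative (𝓡 d) (Euc d) (TangentSpace (𝓡 d) : M → Type) → Prop),
        (∀ B D D', (∀ n, (B n).IsLeviCivita (D n)) →
          CovariantDerivative.ContMDiffCovariantDerivative D' ∞ → Conv B D D' →
          ParallelTransportConverges (fun n => (B n).carrier) D D') →
        ∀ (B : ℕ → DefectBody.{u, w} M 𝒲) (D : ℕ → Conn d M),
          (∀ n, (B n).IsLeviCivita (D n)) →
          ∀ D' : CovariantDerivative (𝓡 d) (Euc d) (TangentSpace (𝓡 d) : M → Type),
            CovariantDerivative.ContMDiffCovariantDerivative D' ∞ → ¬ IsFlat (d := d) (M := M) D' →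
              ¬ Conv B D D') := by
  refine ⟨?_, ?_⟩
  · obtain ⟨ε, hε, h⟩ := exists_disclination_gap.{u, w} h𝒲 hdisc
    exact ⟨ε, hε, fun M _ _ _ _ _ B γ p c hc => h M B γ p c hc⟩
  · intro M _ _ _ _ _ Conv hConv B D hB D' hD' hflat hC
    exact hflat (isFlat_of_parallelTransportConverges h𝒲 hdisc hB hD' (hConv B D D' hB hD' hC))
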